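/- Let $m\ge 1$ and, for $j=1,\dots,m$, let $(Y^{(j)}_n)_{n\ge1}$ be i.i.d. random variables with values in $\mathbb N=\{1,2,\dots\}$, the $m$ sequences being independent of each other. Write $S^{(j)}_0=0$, $S^{(j)}_n=Y^{(j)}_1+\dots+Y^{(j)}_n$ for the corresponding renewal processes, $p^{(j)}_n=\mathbb P(Y^{(j)}_1=n)$ and $\overline F^{(j)}(n)=\mathbb P(Y^{(j)}_1>n)$. Assume that for every $j$: - the law of $Y^{(j)}_1$ is aperiodic, i.e. $\gcd\{n\ge1: p^{(j)}_n>0\}=1$; - $\overline F^{(j)}(n)=n^{-\beta_j}L_j(n)$ for all $n\ge1$, where $\beta_j\in(0,1)$ and $L_j$ is slowly varying at infinity, i.e. $L_j$ is eventually positive and $L_j(\lfloor cn\rfloor)/L_j(n)\to1$ as $n\to\infty$ for every $c>0$; - (Doney's condition) $\sup_{n\ge1} n\,p^{(j)}_n/\overline F^{(j)}(n)<\infty$. Assume moreover that $\beta^*:=\sum_{q=1}^m\beta_q-m+1\in(0,1)$. Let the intersection renewal process be the process of simultaneous renewal times of the $m$ processes; its inter-renewal times $Y^*_1,Y^*_2,\dots$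 are given by $$Y^*_{k+1}=\min\{\ell\in\mathbb N:\ \text{for every } j \text{ there is } n_j\in\mathbb N \text{ with } Y_1^*+\dots+Y_k^*+\ell=S^{(j)}_{n_j}\},\qquad k\ge0,$$ with $\min\emptyset=\infty$. Then its tail $\overline{F^*}(n):=\mathbb P(Y^*_1>n)$ satisfies, as $n\to\infty$, $$\overline{F^*}(n)\sim n^{-\beta^*}L^*(n)\quad\text{with}\quad L^*(n)=\frac{\prod_{q=1}^m\left[\Gamma(\beta_q)\Gamma(1-\beta_q)L_q(n)\right]}{\Gamma(\beta^*)\Gamma(1-\beta^*)}.$$ -/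

import Mathlib

open MeasureTheory ProbabilityTheory Filter Topology Asymptotics

noncomputable section

namespace Renewal

/-- A sequence `L : ℕ → ℝ` is slowly varying at infinity: it is eventually positive and
`L ⌊c n⌋ / L n → 1` as `n → ∞`, for every real `c > 0`. -/
structure SlowlyVarying (L : ℕ → ℝ) : Prop where
  eventually_pos : ∀ᶠ n in atTop, 0 < L n
  tendsto_ratio : ∀ c : ℝ, 0 < c →
    Tendsto (fun n : ℕ => L ⌊c * (n : ℝ)⌋₊ / L n) atTop (𝓝 1)

variable {Ω : Type*} [MeasurableSpace Ω]

/-- `Y 0, Y 1, Y 2, …` are the inter-renewal times (usually written `Y₁, Y₂, Y₃, …`) of a renewal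
process with values in `{1, 2, …}`: they are independent and identically distributed random
variables with values in the positive integers. -/
structure IsRenewalProcess (μ : Measure Ω) (Y : ℕ → Ω → ℕ) : Prop where
  measurable : ∀ i, Measurable (Y i)
  pos : ∀ i ω, 1 ≤ Y i ω
  indep : iIndepFun Y μ
  identDistrib : ∀ i, IdentDistrib (Y i) (Y 0) μ μ

/-- The renewal times `S₀ = 0`, `Sₙ = Y₁ + ⋯ + Yₙ`. -/
def renewalTime (Y : ℕ → Ω → ℕ) (n : ℕ) (ω : Ω) : ℕ := ∑ i ∈ Finset.range n, Y i ω

/-- The tail `F̄(n) = ℙ(Y₁ > n)` of the inter-renewal times. -/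
def tail (μ : Measure Ω) (Y : ℕ → Ω → ℕ) (n : ℕ) : ℝ := μ.real {ω | n < Y 0 ω}

/-- The probability mass function `pₙ = ℙ(Y₁ = n)` of the inter-renewal times. -/
def mass (μ : Measure Ω) (Y : ℕ → Ω → ℕ) (n : ℕ) : ℝ := μ.real {ω | Y 0 ω = n}

/-- The law of the inter-renewal times is aperiodic: the greatest common divisor of
`{n | pₙ > 0}` is `1`. -/
def Aperiodic (μ : Measure Ω) (Y : ℕ → Ω → ℕ) : Prop :=
  ∀ d : ℕ, (∀ n : ℕ, 0 < mass μ Y n → d ∣ n) → d = 1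

/-- Doney's condition `sup_{n ≥ 1} n pₙ / F̄(n) < ∞` (the term at `n = 0` vanishes). -/
def DoneyCondition (μ : Measure Ω) (Y : ℕ → Ω → ℕ) : Prop :=
  BddAbove (Set.range fun n : ℕ => (n : ℝ) * mass μ Y n / tail μ Y n)

variable {m : ℕ}

/-- The set of positive integers that are renewal times of all `m` processes. -/
def commonRenewals (Y : Fin m → ℕ → Ω → ℕ) (ω : Ω) : Set ℕ :=
  {t | 1 ≤ t ∧ ∀ k : Fin m, ∃ n : ℕ, 1 ≤ n ∧ t = renewalTime (Y k) n ω}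

/-- The waiting time from `t` to the next simultaneous renewal: the least `l ≥ 1` such that
`t + l` is a renewal time of all processes, and `∞` if there is no such `l`. -/
def nextGap (Y : Fin m → ℕ → Ω → ℕ) (ω : Ω) (t : ℕ∞) : ℕ∞ :=
  sInf {x : ℕ∞ | ∃ l : ℕ, x = (l : ℕ∞) ∧ 1 ≤ l ∧
    ∃ s ∈ commonRenewals Y ω, (s : ℕ∞) = t + (l : ℕ∞)}

/-- The renewal times of the intersection renewal process (`0`, then the successive
simultaneous renewal times). -/
def interTime (Y : Fin m → ℕ → Ω → ℕ) (ω : Ω) : ℕ → ℕ∞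
  | 0 => 0
  | k + 1 => interTime Y ω k + nextGap Y ω (interTime Y ω k)

/-- The inter-renewal times of the intersection renewal process; `interGap Y k` is
`Y*₍ₖ₊₁₎`, so that `interGap Y 0` is `Y*₁`. -/
def interGap (Y : Fin m → ℕ → Ω → ℕ) (k : ℕ) (ω : Ω) : ℕ∞ :=
  nextGap Y ω (interTime Y ω k)

/-- The tail `F̄*(n) = ℙ(Y*₁ > n)` of the intersection renewal process. -/
def interTail (μ : Measure Ω) (Y : Fin m → ℕ → Ω → ℕ) (n : ℕ) : ℝ :=
  μ.real {ω | (n : ℕ∞) < interGap Y 0 ω}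

/-- The exponent `β* = β₁ + ⋯ + βₘ - m + 1`. -/
def betaStar (β : Fin m → ℝ) : ℝ := ∑ q, β q - (m : ℝ) + 1

/-- The function
`L*(n) = ∏_q [Γ(β_q) Γ(1 - β_q) L_q(n)] / (Γ(β*) Γ(1 - β*))`. -/
def LStar (β : Fin m → ℝ) (L : Fin m → ℕ → ℝ) (n : ℕ) : ℝ :=
  (∏ q, Real.Gamma (β q) * Real.Gamma (1 - β q) * L q n) /
    (Real.Gamma (betaStar β) * Real.Gamma (1 - betaStar β))

end Renewal

end

/-! By independence, the probability `u n` that `n` is a renewal time of all `m` processes is the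
product of the `m` individual renewal masses. Doney's strong renewal theorem
(`RegVarLaw.tendsto_renewal_mass`) makes each of these asymptotic to `1 / (Γ(β) Γ(1 - β) n F̄(n))`.
Hence `u n ~ 1 / (n g n)`, where `g n = n ^ (m - 1) ∏ Γ(β_q) Γ(1 - β_q) F̄_q(n)` is regularly
varying of index `-β*`. Decomposing at the last common renewal up to `n` gives `∑ u k F̄*(n - k) =
1` (`sum_mul_lastCommonSet`).

The tail is recovered from this equation by `RegVar.tendsto_tail`. The convolution of `u` and `g`
tends to a beta integral, `B = Γ(β*) Γ(1 - β*)`. Associativity turns `F̄* ∗ (u ∗ g)` into `1 ∗ g`,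
so `B ∑ F̄*` is asymptotic to `∑ g ~ n g n / (1 - β*)`. As `F̄*` is monotone, the monotone density
theorem yields `F̄* ~ g / B`, which is the claim.

For the strong renewal theorem put `U = 1 / (1 - P)` and `V = 1 / (1 + ε - P)`, with `P` the
generating function of the gaps. Iterating the resolvent identity, `U = ∑_{i < M} ε^i V^(i+1) + ε^M
U V^M`. Doney's condition bounds the coefficients of the sum by a multiple of `1 / (ε n)`, through
the derivative `V' = V² P'`. With `ε = F̄(n) / δ` this part is of order `δ` after multiplication by
`n F̄(n)`. The coefficients of the last term are Fourier integrals, which converge after rescaling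
by dominated convergence once `M` is large. So `n F̄(n) u n` has a limit, and the renewal equation
determines its value. -/

namespace Renewal

/-! ### Regularly varying sequences and Potter bounds. -/

/-- A sequence that is regularly varying of index `-β`, together with its Potter bounds. -/
structure RegVar (β : ℝ) (g : ℕ → ℝ) : Prop where
  pos : ∀ n, 1 ≤ n → 0 < g n
  ratio : ∀ y : ℝ, 0 < y → ∀ k : ℕ → ℕ, Tendsto (fun n => (k n : ℝ) / n) atTop (𝓝 y) →
    Tendsto (fun n => g (k n) / g n) atTop (𝓝 (y ^ (-β)))
  upper : ∀ γ, β < γ → ∃ C, ∀ m n : ℕ, 1 ≤ m → m ≤ n → g m ≤ C * g n * ((n : ℝ) / m) ^ γ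
  lower : ∀ γ, γ < β → ∃ C, ∀ m n : ℕ, 1 ≤ m → m ≤ n → g n ≤ C * g m * ((n : ℝ) / m) ^ (-γ)

theorem RegVar.congr {β β' : ℝ} {g g' : ℕ → ℝ} (h : RegVar β g) (hβ : β = β')
    (hg : ∀ n, 1 ≤ n → g n = g' n) : RegVar β' g' := by
  subst hβ
  refine ⟨fun n hn => hg n hn ▸ h.pos n hn, fun y hy k hk => ?_, fun γ hγ => ?_, fun γ hγ => ?_⟩
  · refine (h.ratio y hy k hk).congr' ?_
    have h1 : ∀ᶠ n in atTop, 0 < (k n : ℝ) / n := hk.eventually (lt_mem_nhds hy)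
    filter_upwards [h1, eventually_ge_atTop 1] with n hn1 hn
    have : 1 ≤ k n := by
      rcases Nat.eq_zero_or_pos (k n) with h0 | h0
      · simp [h0] at hn1
      · exact h0
    rw [hg _ this, hg _ hn]
  · obtain ⟨C, hC⟩ := h.upper γ hγ
    exact ⟨C, fun m n hm hmn => by
      rw [← hg m hm, ← hg n (hm.trans hmn)]; exact hC m n hm hmn⟩
  · obtain ⟨C, hC⟩ := h.lower γ hγ
    exact ⟨C, fun m n hm hmn => by
      rw [← hg m hm, ← hg n (hm.trans hmn)]; exact hC m n hm hmn⟩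

theorem RegVar.mul {β₁ β₂ : ℝ} {g₁ g₂ : ℕ → ℝ} (h₁ : RegVar β₁ g₁) (h₂ : RegVar β₂ g₂) :
    RegVar (β₁ + β₂) (fun n => g₁ n * g₂ n) := by
  refine ⟨fun n hn => mul_pos (h₁.pos n hn) (h₂.pos n hn), fun y hy k hk => ?_, fun γ hγ => ?_,
    fun γ hγ => ?_⟩
  · have := (h₁.ratio y hy k hk).mul (h₂.ratio y hy k hk)
    rw [← Real.rpow_add hy] at this
    refine (this.congr fun n => (mul_div_mul_comm _ _ _ _).symm).trans (le_of_eq ?_)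
    congr 2; ring
  -- The room between `γ` and `β₁ + β₂` is shared equally by the two factors.
  · obtain ⟨C, hC⟩ := h₁.upper (β₁ + (γ - β₁ - β₂) / 2) (by linarith)
    obtain ⟨D, hD⟩ := h₂.upper (β₂ + (γ - β₁ - β₂) / 2) (by linarith)
    refine ⟨C * D, fun m n hm hmn => ?_⟩
    have hm0 : (0 : ℝ) < m := by exact_mod_cast hm
    have hn0 : (0 : ℝ) < n := by exact_mod_cast hm.trans hmn
    have := mul_le_mul (hC m n hm hmn) (hD m n hm hmn) (h₂.pos m hm).le
      ((h₁.pos m hm).le.trans (hC m n hm hmn))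
    refine this.trans (le_of_eq ?_)
    have e : γ = (β₁ + (γ - β₁ - β₂) / 2) + (β₂ + (γ - β₁ - β₂) / 2) := by ring
    conv_rhs => rw [e, Real.rpow_add (div_pos hn0 hm0)]
    ring
  · obtain ⟨C, hC⟩ := h₁.lower (β₁ + (γ - β₁ - β₂) / 2) (by linarith)
    obtain ⟨D, hD⟩ := h₂.lower (β₂ + (γ - β₁ - β₂) / 2) (by linarith)
    refine ⟨C * D, fun m n hm hmn => ?_⟩
    have hm0 : (0 : ℝ) < m := by exact_mod_cast hm
    have hn1 : 1 ≤ n := hm.trans hmn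
    have hn0 : (0 : ℝ) < n := by exact_mod_cast hn1
    have := mul_le_mul (hC m n hm hmn) (hD m n hm hmn) (h₂.pos n hn1).le
      ((h₁.pos n hn1).le.trans (hC m n hm hmn))
    refine this.trans (le_of_eq ?_)
    have e : -γ = -(β₁ + (γ - β₁ - β₂) / 2) + -(β₂ + (γ - β₁ - β₂) / 2) := by ring
    conv_rhs => rw [e, Real.rpow_add (div_pos hn0 hm0)]
    ring

theorem RegVar.inv {β : ℝ} {g : ℕ → ℝ} (h : RegVar β g) : RegVar (-β) (fun n => (g n)⁻¹) := by
  refine ⟨fun n hn => inv_pos.2 (h.pos n hn), fun y hy k hk => ?_, fun γ hγ => ?_,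
    fun γ hγ => ?_⟩
  · have := (h.ratio y hy k hk).inv₀ (Real.rpow_pos_of_pos hy _).ne'
    rw [← Real.rpow_neg hy.le] at this
    exact this.congr fun n => by rw [inv_div, div_eq_mul_inv, div_eq_mul_inv, inv_inv, mul_comm]
  · obtain ⟨C, hC⟩ := h.lower (-γ) (by linarith)
    refine ⟨C, fun m n hm hmn => ?_⟩
    have := hC m n hm hmn
    have h1 := h.pos m hm
    have h2 := h.pos n (hm.trans hmn)
    rw [neg_neg] at this
    rw [inv_eq_one_div, div_le_iff₀ h1]
    calc (1 : ℝ) = (g n)⁻¹ * g n := by field_simp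
      _ ≤ (g n)⁻¹ * (C * g m * ((n : ℝ) / m) ^ γ) := by gcongr
      _ = _ := by ring
  · obtain ⟨C, hC⟩ := h.upper (-γ) (by linarith)
    refine ⟨C, fun m n hm hmn => ?_⟩
    have := hC m n hm hmn
    have h1 := h.pos m hm
    have h2 := h.pos n (hm.trans hmn)
    rw [inv_eq_one_div, div_le_iff₀ h2]
    calc (1 : ℝ) = (g m)⁻¹ * g m := by field_simp
      _ ≤ (g m)⁻¹ * (C * g n * ((n : ℝ) / m) ^ (-γ)) := by gcongr
      _ = _ := by ring

theorem RegVar.rpow (s : ℝ) : RegVar (-s) (fun n => (n : ℝ) ^ s) := by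
  refine ⟨fun n hn => Real.rpow_pos_of_pos (by exact_mod_cast hn) _, fun y hy k hk => ?_,
    fun γ hγ => ⟨1, fun m n hm hmn => ?_⟩, fun γ hγ => ⟨1, fun m n hm hmn => ?_⟩⟩
  · rw [neg_neg]
    refine (hk.rpow_const (Or.inl hy.ne')).congr fun n => ?_
    rw [Real.div_rpow (Nat.cast_nonneg _) (Nat.cast_nonneg _)]
  · have hm0 : (0 : ℝ) < m := by exact_mod_cast hm
    have hn0 : (0 : ℝ) < n := by exact_mod_cast hm.trans hmn
    have h1 : (1 : ℝ) ≤ (n : ℝ) / m := by rw [one_le_div hm0]; exact_mod_cast hmn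
    have : (1 : ℝ) ≤ ((n : ℝ) / m) ^ s * ((n : ℝ) / m) ^ γ := by
      rw [← Real.rpow_add (by positivity)]
      exact Real.one_le_rpow h1 (by linarith)
    rw [Real.div_rpow hn0.le hm0.le s, div_mul_eq_mul_div, one_le_div (by positivity)] at this
    linarith
  · have hm0 : (0 : ℝ) < m := by exact_mod_cast hm
    have hn0 : (0 : ℝ) < n := by exact_mod_cast hm.trans hmn
    have h1 : (1 : ℝ) ≤ (n : ℝ) / m := by rw [one_le_div hm0]; exact_mod_cast hmn
    have : ((n : ℝ) / m) ^ s ≤ ((n : ℝ) / m) ^ (-γ) :=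
      Real.rpow_le_rpow_of_exponent_le h1 (by linarith)
    rw [Real.div_rpow hn0.le hm0.le s, div_le_iff₀ (by positivity)] at this
    linarith

theorem RegVar.one : RegVar 0 (fun _ => 1) :=
  (RegVar.rpow 0).congr (by simp) (fun n _ => by simp)

theorem RegVar.prod {ι : Type*} (s : Finset ι) {β : ι → ℝ} {g : ι → ℕ → ℝ}
    (h : ∀ i ∈ s, RegVar (β i) (g i)) : RegVar (∑ i ∈ s, β i) (fun n => ∏ i ∈ s, g i n) := by
  classical
  induction s using Finset.induction_on with
  | empty => simpa using RegVar.one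
  | insert a s ha ih =>
    refine ((h a (Finset.mem_insert_self _ _)).mul
      (ih fun i hi => h i (Finset.mem_insert_of_mem hi))).congr
      (Finset.sum_insert ha).symm fun n _ => ?_
    exact (Finset.prod_insert (f := fun i => g i n) ha).symm

theorem exists_pow_two_mul {m n : ℕ} (hm : 1 ≤ m) (hmn : m ≤ n) :
    ∃ k : ℕ, 2 ^ k * m ≤ n ∧ n < 2 ^ (k + 1) * m := by
  refine ⟨Nat.log 2 (n / m), ?_, ?_⟩
  · exact (Nat.le_div_iff_mul_le hm).1 (Nat.pow_log_le_self 2 (Nat.div_pos hmn hm).ne')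
  · exact (Nat.div_lt_iff_lt_mul hm).1 (Nat.lt_pow_succ_log_self (by norm_num) _)

/-- Since `2 ^ (-γ) < 2 ^ (-β)`, doubling the argument costs at most a factor `2 ^ γ` from some `N0`
on. Iteration gives dyadic ratios, and monotonicity fills the gaps between them. -/
theorem upper_of_antitone {β : ℝ} {f : ℕ → ℝ} (hβ : 0 < β) (hpos : ∀ n, 0 < f n)
    (hanti : Antitone f) (h2 : Tendsto (fun n => f (2 * n) / f n) atTop (𝓝 ((2 : ℝ) ^ (-β))))
    {γ : ℝ} (hγ : β < γ) :
    ∃ C, ∀ m n : ℕ, 1 ≤ m → m ≤ n → f m ≤ C * f n * ((n : ℝ) / m) ^ γ := by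
  have hγ0 : 0 < γ := hβ.trans hγ
  have hlt : (2 : ℝ) ^ (-γ) < 2 ^ (-β) :=
    Real.rpow_lt_rpow_of_exponent_lt (by norm_num) (by linarith)
  obtain ⟨N, hN⟩ := eventually_atTop.1 (h2.eventually (lt_mem_nhds hlt))
  set N0 := max N 1 with hN0
  have hstep : ∀ m, N0 ≤ m → f m ≤ 2 ^ γ * f (2 * m) := fun m hm => by
    have := hN m ((le_max_left _ _).trans hm)
    rw [lt_div_iff₀ (hpos m), Real.rpow_neg (by norm_num), inv_mul_lt_iff₀ (by positivity)] at this
    exact this.le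
  have hiter : ∀ k m, N0 ≤ m → f m ≤ ((2 : ℝ) ^ k) ^ γ * f (2 ^ k * m) := by
    intro k
    induction k with
    | zero => intro m _; simp
    | succ k ih =>
      intro m hm
      refine (ih m hm).trans ?_
      have h1 := hstep (2 ^ k * m) (hm.trans (Nat.le_mul_of_pos_left _ (by positivity)))
      have e : 2 ^ (k + 1) * m = 2 * (2 ^ k * m) := by ring
      rw [e, pow_succ, Real.mul_rpow (by positivity) (by norm_num), mul_assoc]
      exact mul_le_mul_of_nonneg_left h1 (by positivity)
  have hbig : ∀ m n : ℕ, N0 ≤ m → m ≤ n → f m ≤ 2 ^ γ * f n * ((n : ℝ) / m) ^ γ := by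
    intro m n hm hmn
    have hm1 : 1 ≤ m := (le_max_right _ _).trans hm
    have hm0 : (0 : ℝ) < m := by exact_mod_cast hm1
    obtain ⟨k, hk1, hk2⟩ := exists_pow_two_mul hm1 hmn
    have hk1' : (2 : ℝ) ^ k * m ≤ n := by exact_mod_cast hk1
    calc f m ≤ ((2 : ℝ) ^ (k + 1)) ^ γ * f (2 ^ (k + 1) * m) := hiter _ _ hm
      _ ≤ (2 * ((n : ℝ) / m)) ^ γ * f n := by
        refine mul_le_mul (Real.rpow_le_rpow (by positivity) ?_ hγ0.le) (hanti hk2.le) (hpos _).le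
          (by positivity)
        rw [pow_succ, mul_comm]
        gcongr
        rwa [le_div_iff₀ hm0]
      _ = _ := by rw [Real.mul_rpow (by norm_num) (by positivity)]; ring
  -- The finitely many indices below `N0` cost at most this factor.
  set D := f 1 / f N0 with hD
  have hD1 : 1 ≤ D := by rw [hD, one_le_div (hpos _)]; exact hanti (le_max_right _ _)
  refine ⟨D * 2 ^ γ, fun m n hm hmn => ?_⟩
  have hm0 : (0 : ℝ) < m := by exact_mod_cast hm
  have hfn := hpos n
  have h1 : (1 : ℝ) ≤ (n : ℝ) / m := by rw [one_le_div hm0]; exact_mod_cast hmn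
  have h2γ : (1 : ℝ) ≤ 2 ^ γ := Real.one_le_rpow (by norm_num) hγ0.le
  have hx : (1 : ℝ) ≤ ((n : ℝ) / m) ^ γ := Real.one_le_rpow h1 hγ0.le
  rcases le_or_gt N0 m with h | h
  · refine (hbig m n h hmn).trans ?_
    rw [mul_assoc D, mul_assoc D]
    exact le_mul_of_one_le_left (by positivity) hD1
  · have hfm : f m ≤ D * f N0 := by
      rw [hD, div_mul_cancel₀ _ (hpos _).ne']; exact hanti hm
    refine hfm.trans ?_
    rw [mul_assoc, mul_assoc D]
    refine mul_le_mul_of_nonneg_left ?_ (by linarith)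
    rcases le_or_gt N0 n with h' | h'
    · refine (hbig N0 n le_rfl h').trans ?_
      rw [mul_assoc]
      gcongr
    · refine (hanti h'.le).trans ?_
      calc f n = 1 * (f n * 1) := by ring
        _ ≤ _ := by gcongr

/-- The doubling argument with the inequality reversed. For `γ ≤ 0` monotonicity alone is enough. -/
theorem lower_of_antitone {β : ℝ} {f : ℕ → ℝ} (hpos : ∀ n, 0 < f n)
    (hanti : Antitone f) (h2 : Tendsto (fun n => f (2 * n) / f n) atTop (𝓝 ((2 : ℝ) ^ (-β))))
    {γ : ℝ} (hγ : γ < β) :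
    ∃ C, ∀ m n : ℕ, 1 ≤ m → m ≤ n → f n ≤ C * f m * ((n : ℝ) / m) ^ (-γ) := by
  rcases le_or_gt γ 0 with hγ0 | hγ0
  · refine ⟨1, fun m n hm hmn => ?_⟩
    have hm0 : (0 : ℝ) < m := by exact_mod_cast hm
    have h1 : (1 : ℝ) ≤ (n : ℝ) / m := by rw [one_le_div hm0]; exact_mod_cast hmn
    rw [one_mul]
    exact (hanti hmn).trans (le_mul_of_one_le_right (hpos m).le
      (Real.one_le_rpow h1 (by linarith)))
  have hlt : (2 : ℝ) ^ (-β) < 2 ^ (-γ) :=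
    Real.rpow_lt_rpow_of_exponent_lt (by norm_num) (by linarith)
  obtain ⟨N, hN⟩ := eventually_atTop.1 (h2.eventually (gt_mem_nhds hlt))
  set N0 := max N 1 with hN0
  have hN01 : (1 : ℝ) ≤ N0 := by exact_mod_cast le_max_right N 1
  have hstep : ∀ m, N0 ≤ m → f (2 * m) ≤ 2 ^ (-γ) * f m := fun m hm => by
    have := hN m ((le_max_left _ _).trans hm)
    rw [div_lt_iff₀ (hpos m)] at this
    exact this.le
  have hiter : ∀ k m, N0 ≤ m → f (2 ^ k * m) ≤ ((2 : ℝ) ^ k) ^ (-γ) * f m := by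
    intro k
    induction k with
    | zero => intro m _; simp
    | succ k ih =>
      intro m hm
      have h1 := hstep (2 ^ k * m) (hm.trans (Nat.le_mul_of_pos_left _ (by positivity)))
      have e : 2 ^ (k + 1) * m = 2 * (2 ^ k * m) := by ring
      rw [e]
      refine h1.trans ?_
      rw [pow_succ, Real.mul_rpow (by positivity) (by norm_num), mul_comm (_ ^ _) ((2 : ℝ) ^ (-γ)),
        mul_assoc]
      exact mul_le_mul_of_nonneg_left (ih m hm) (by positivity)
  have hbig : ∀ m n : ℕ, N0 ≤ m → m ≤ n → f n ≤ 2 ^ γ * f m * ((n : ℝ) / m) ^ (-γ) := by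
    intro m n hm hmn
    have hm1 : 1 ≤ m := (le_max_right _ _).trans hm
    have hm0 : (0 : ℝ) < m := by exact_mod_cast hm1
    have hn0 : (0 : ℝ) < n := by exact_mod_cast hm1.trans hmn
    obtain ⟨k, hk1, hk2⟩ := exists_pow_two_mul hm1 hmn
    have hk2' : (n : ℝ) < 2 ^ (k + 1) * m := by exact_mod_cast hk2
    calc f n ≤ f (2 ^ k * m) := hanti hk1
      _ ≤ ((2 : ℝ) ^ k) ^ (-γ) * f m := hiter _ _ hm
      _ ≤ ((n : ℝ) / m / 2) ^ (-γ) * f m := by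
        refine mul_le_mul_of_nonneg_right ?_ (hpos _).le
        refine Real.rpow_le_rpow_of_nonpos (by positivity) ?_ (by linarith)
        rw [div_div, div_le_iff₀ (by positivity)]
        rw [pow_succ] at hk2'
        linarith
      _ = _ := by
        rw [Real.div_rpow (by positivity) (by norm_num), Real.rpow_neg (by norm_num : (0 : ℝ) ≤ 2)]
        rw [div_inv_eq_mul]; ring
  refine ⟨(N0 : ℝ) ^ γ * 2 ^ γ, fun m n hm hmn => ?_⟩
  have hm0 : (0 : ℝ) < m := by exact_mod_cast hm
  have hm1 : (1 : ℝ) ≤ m := by exact_mod_cast hm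
  have hn0 : (0 : ℝ) < n := by exact_mod_cast hm.trans hmn
  have hfm := hpos m
  have hfn := hpos n
  have h2γ : (1 : ℝ) ≤ 2 ^ γ := Real.one_le_rpow (by norm_num) hγ0.le
  have hNγ : (1 : ℝ) ≤ (N0 : ℝ) ^ γ := Real.one_le_rpow hN01 hγ0.le
  rcases le_or_gt N0 m with h | h
  · refine (hbig m n h hmn).trans ?_
    rw [mul_assoc, mul_assoc _ (f m), mul_assoc]
    exact le_mul_of_one_le_left (by positivity) hNγ
  · rcases le_or_gt N0 n with h' | h'
    · refine (hbig N0 n le_rfl h').trans ?_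
      have e : ((n : ℝ) / N0) ^ (-γ) ≤ (N0 : ℝ) ^ γ * ((n : ℝ) / m) ^ (-γ) := by
        have : ((n : ℝ) / N0) ^ (-γ) = (N0 : ℝ) ^ γ * (n : ℝ) ^ (-γ) := by
          rw [Real.div_rpow hn0.le (by positivity), Real.rpow_neg (by positivity : (0 : ℝ) ≤ N0),
            div_inv_eq_mul, mul_comm]
        rw [this]
        refine mul_le_mul_of_nonneg_left ?_ (by positivity)
        exact Real.rpow_le_rpow_of_nonpos (by positivity) (div_le_self hn0.le hm1) (by linarith)
      calc 2 ^ γ * f N0 * ((n : ℝ) / N0) ^ (-γ)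
          ≤ 2 ^ γ * f m * ((N0 : ℝ) ^ γ * ((n : ℝ) / m) ^ (-γ)) := by
            gcongr
            exact hanti h.le
        _ = _ := by ring
    · have e : 1 ≤ (N0 : ℝ) ^ γ * ((n : ℝ) / m) ^ (-γ) := by
        rw [Real.rpow_neg (by positivity), ← div_eq_mul_inv, one_le_div (by positivity)]
        refine Real.rpow_le_rpow (by positivity) ((div_le_self hn0.le hm1).trans ?_) hγ0.le
        exact_mod_cast h'.le
      calc f n ≤ f m := hanti hmn
        _ = 1 * 1 * f m := by ring
        _ ≤ 2 ^ γ * ((N0 : ℝ) ^ γ * ((n : ℝ) / m) ^ (-γ)) * f m := by gcongr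
        _ = _ := by ring

/-- Monotonicity replaces the uniform convergence theorem: `k n` is eventually caught between `⌊c
n⌋` for values of `c` on either side of `y`, and continuity of `c ^ (-β)` closes the gap. -/
theorem RegVar.of_antitone {β : ℝ} {f : ℕ → ℝ} (hβ : 0 < β) (hpos : ∀ n, 0 < f n)
    (hanti : Antitone f)
    (h : ∀ c : ℝ, 0 < c → Tendsto (fun n : ℕ => f ⌊c * (n : ℝ)⌋₊ / f n) atTop (𝓝 (c ^ (-β)))) :
    RegVar β f := by
  have h2 : Tendsto (fun n => f (2 * n) / f n) atTop (𝓝 ((2 : ℝ) ^ (-β))) := by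
    refine (h 2 (by norm_num)).congr fun n => ?_
    have : (2 : ℝ) * n = ((2 * n : ℕ) : ℝ) := by push_cast; ring
    rw [this, Nat.floor_natCast]
  refine ⟨fun n _ => hpos n, fun y hy k hk => ?_, fun γ hγ => upper_of_antitone hβ hpos hanti h2 hγ,
    fun γ hγ => lower_of_antitone hpos hanti h2 hγ⟩
  have hcont : ContinuousAt (fun c : ℝ => c ^ (-β)) y :=
    Real.continuousAt_rpow_const _ _ (Or.inl hy.ne')
  have hev : ∀ᶠ n in atTop, (1 : ℕ) ≤ n := eventually_ge_atTop 1
  refine tendsto_order.2 ⟨fun a ha => ?_, fun a ha => ?_⟩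
  · have h1 : ∀ᶠ c in 𝓝[>] y, a < c ^ (-β) ∧ y < c := by
      refine ((hcont.eventually (lt_mem_nhds ha)).filter_mono nhdsWithin_le_nhds).and ?_
      exact self_mem_nhdsWithin
    obtain ⟨c, hc, hyc⟩ := h1.exists
    filter_upwards [(h c (hy.trans hyc)).eventually (lt_mem_nhds hc),
      hk.eventually (gt_mem_nhds hyc), hev] with n h3 h4 h5
    refine h3.trans_le (div_le_div_of_nonneg_right (hanti (Nat.le_floor ?_)) (hpos n).le)
    rw [div_lt_iff₀ (by exact_mod_cast h5)] at h4
    exact h4.le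
  · have h1 : ∀ᶠ c in 𝓝[<] y, c ^ (-β) < a ∧ c ∈ Set.Ioo 0 y := by
      refine ((hcont.eventually (gt_mem_nhds ha)).filter_mono nhdsWithin_le_nhds).and ?_
      exact Ioo_mem_nhdsLT hy
    obtain ⟨c, hc, hc0, hyc⟩ := h1.exists
    filter_upwards [(h c hc0).eventually (gt_mem_nhds hc),
      hk.eventually (lt_mem_nhds hyc), hev] with n h3 h4 h5
    refine (div_le_div_of_nonneg_right (hanti (Nat.floor_le_of_le ?_)) (hpos n).le).trans_lt h3
    rw [lt_div_iff₀ (by exact_mod_cast h5)] at h4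
    exact h4.le

end Renewal

/-! ### Riemann sums, beta integrals and Karamata's theorem. -/

namespace Renewal

section Riemann
variable {E : Type*} [NormedAddCommGroup E] [NormedSpace ℝ E] [CompleteSpace E]

theorem intervalIntegrable_floor {E : Type*} [NormedAddCommGroup E] (g : ℕ → E) (k : ℕ) :
    IntervalIntegrable (fun y : ℝ => g ⌊y⌋₊) volume (k : ℝ) ((k + 1 : ℕ) : ℝ) := by
  rw [intervalIntegrable_iff_integrableOn_Ico_of_le (by simp)]
  refine (integrableOn_const (C := g k) (by simp)).congr_fun (fun y hy => ?_) measurableSet_Ico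
  have : ⌊y⌋₊ = k := (Nat.floor_eq_iff ((Nat.cast_nonneg k).trans hy.1)).2
    ⟨hy.1, by have := hy.2; push_cast at this; exact this⟩
  simp [this]

theorem integral_floor (g : ℕ → E) (k : ℕ) :
    ∫ y in (k : ℝ)..((k + 1 : ℕ) : ℝ), g ⌊y⌋₊ = g k := by
  rw [intervalIntegral.integral_of_le (by simp), ← integral_Ico_eq_integral_Ioc]
  have : ∫ y in Set.Ico (k : ℝ) ((k + 1 : ℕ) : ℝ), g ⌊y⌋₊
      = ∫ y in Set.Ico (k : ℝ) ((k + 1 : ℕ) : ℝ), g k := by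
    refine setIntegral_congr_fun measurableSet_Ico fun y hy => ?_
    have : ⌊y⌋₊ = k := (Nat.floor_eq_iff ((Nat.cast_nonneg k).trans hy.1)).2
      ⟨hy.1, by have := hy.2; push_cast at this; exact this⟩
    simp [this]
  rw [this]
  simp

theorem inv_smul_sum_eq_integral (g : ℕ → E) {n : ℕ} (hn : 0 < n) (M : ℕ) :
    (n : ℝ)⁻¹ • ∑ k ∈ Finset.range (n * M), g k = ∫ x in (0 : ℝ)..M, g ⌊(n : ℝ) * x⌋₊ := by
  have hn0 : (n : ℝ) ≠ 0 := by positivity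
  rw [intervalIntegral.integral_comp_mul_left (fun y => g ⌊y⌋₊) hn0, mul_zero]
  have := intervalIntegral.sum_integral_adjacent_intervals (μ := volume)
    (f := fun y : ℝ => g ⌊y⌋₊) (a := fun k : ℕ => (k : ℝ)) (n := n * M)
    (fun k _ => intervalIntegrable_floor g k)
  simp_rw [integral_floor] at this
  rw [this]
  push_cast
  rfl

/-- The rescaled sum is the integral of a step function, so dominated convergence applies. An
integrable majorant that may blow up at the endpoints is what the singular powers in the
applications require. -/
theorem tendsto_riemann_sum {H : ℕ → ℕ → E} {h : ℝ → E} {b : ℝ → ℝ} {M : ℕ}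
    (hb : IntegrableOn b (Set.Ioo 0 M)) (hb0 : ∀ x ∈ Set.Ioo (0 : ℝ) M, 0 ≤ b x)
    (hbound : ∀ n k : ℕ, ∀ x ∈ Set.Ioo (0 : ℝ) M, 1 ≤ n → 1 ≤ k → k = ⌊(n : ℝ) * x⌋₊ →
      ‖H n k‖ ≤ b x)
    (hlim : ∀ x ∈ Set.Ioo (0 : ℝ) M, Tendsto (fun n : ℕ => H n ⌊(n : ℝ) * x⌋₊) atTop (𝓝 (h x))) :
    Tendsto (fun n : ℕ => (n : ℝ)⁻¹ • ∑ k ∈ Finset.Ico 1 (n * M), H n k) atTop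
      (𝓝 (∫ x in (0 : ℝ)..M, h x)) := by
  have hM : (0 : ℝ) ≤ M := Nat.cast_nonneg _
  -- No bound is assumed at `k = 0`, so that term is replaced by `0`; at a fixed `x > 0` it is not
  -- met once `n` is large.
  set K : ℕ → ℕ → E := fun n k => if k = 0 then 0 else H n k with hK
  have key : Tendsto (fun n : ℕ => ∫ x in Set.Ioo (0 : ℝ) M, K n ⌊(n : ℝ) * x⌋₊) atTop
      (𝓝 (∫ x in Set.Ioo (0 : ℝ) M, h x)) := by
    refine tendsto_integral_filter_of_dominated_convergence b ?_ ?_ hb ?_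
    · refine Eventually.of_forall fun n => ?_
      have h1 : Measurable (fun x : ℝ => ⌊(n : ℝ) * x⌋₊) :=
        Nat.measurable_floor.comp (measurable_const_mul _)
      exact ((StronglyMeasurable.of_discrete (f := K n)).comp_measurable h1).aestronglyMeasurable
    · filter_upwards [eventually_ge_atTop 1] with n hn
      refine (ae_restrict_iff' measurableSet_Ioo).2 (Eventually.of_forall fun x hx => ?_)
      by_cases hk : ⌊(n : ℝ) * x⌋₊ = 0
      · simp only [hK, hk, if_true, norm_zero]
        exact hb0 x hx
      · simp only [hK, hk, if_false]
        exact hbound n _ x hx hn (Nat.one_le_iff_ne_zero.2 hk) rfl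
    · refine (ae_restrict_iff' measurableSet_Ioo).2 (Eventually.of_forall fun x hx => ?_)
      refine (hlim x hx).congr' ?_
      have h1 : Tendsto (fun n : ℕ => (n : ℝ) * x) atTop atTop :=
        tendsto_natCast_atTop_atTop.atTop_mul_const hx.1
      filter_upwards [h1.eventually_ge_atTop 1] with n hn
      have : ⌊(n : ℝ) * x⌋₊ ≠ 0 := by
        rw [← Nat.one_le_iff_ne_zero]
        exact Nat.le_floor (by simpa using hn)
      simp only [hK, this, if_false]
  rw [intervalIntegral.integral_of_le hM, integral_Ioc_eq_integral_Ioo]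
  refine key.congr' ?_
  filter_upwards [eventually_ge_atTop 1] with n hn
  rw [← integral_Ioc_eq_integral_Ioo, ← intervalIntegral.integral_of_le hM,
    ← inv_smul_sum_eq_integral (K n) hn]
  congr 1
  rcases Nat.eq_zero_or_pos (n * M) with h0 | h0
  · simp [h0]
  · rw [Finset.range_eq_Ico, Finset.sum_eq_sum_Ico_succ_bot h0]
    simp only [hK, if_true, zero_add]
    refine Finset.sum_congr rfl fun k hk => ?_
    rw [if_neg (by have := (Finset.mem_Ico.1 hk).1; omega)]

end Riemann

theorem integral_beta {u v : ℝ} (hu : 0 < u) (hv : 0 < v) :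
    ∫ x in (0 : ℝ)..1, x ^ (u - 1) * (1 - x) ^ (v - 1)
      = Real.Gamma u * Real.Gamma v / Real.Gamma (u + v) := by
  have h := Complex.betaIntegral_eq_Gamma_mul_div (u : ℂ) v (by simpa) (by simpa)
  rw [← Complex.ofReal_add, Complex.Gamma_ofReal, Complex.Gamma_ofReal, Complex.Gamma_ofReal,
    Complex.betaIntegral] at h
  have h2 : ∫ x in (0 : ℝ)..1, (x : ℂ) ^ ((u : ℂ) - 1) * (1 - (x : ℂ)) ^ ((v : ℂ) - 1)
      = ∫ x in (0 : ℝ)..1, ((x ^ (u - 1) * (1 - x) ^ (v - 1) : ℝ) : ℂ) := by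
    refine intervalIntegral.integral_congr fun x hx => ?_
    rw [Set.uIcc_of_le zero_le_one] at hx
    rw [Complex.ofReal_mul, Complex.ofReal_cpow hx.1, Complex.ofReal_cpow (by linarith [hx.2])]
    push_cast
    rfl
  rw [h2, intervalIntegral.integral_ofReal] at h
  exact_mod_cast h

theorem integrableOn_beta {u v : ℝ} (hu : 0 < u) (hv : 0 < v) :
    IntegrableOn (fun x : ℝ => x ^ (u - 1) * (1 - x) ^ (v - 1)) (Set.Ioo 0 1) := by
  have h := Complex.betaIntegral_convergent (u := (u : ℂ)) (v := v) (by simpa) (by simpa)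
  rw [intervalIntegrable_iff_integrableOn_Ioo_of_le zero_le_one] at h
  refine IntegrableOn.congr_fun h.norm (fun x hx => ?_) measurableSet_Ioo
  have h1 : (0 : ℝ) < 1 - x := by linarith [hx.2]
  have e : (1 : ℂ) - x = ((1 - x : ℝ) : ℂ) := by push_cast; rfl
  rw [norm_mul, Complex.norm_cpow_eq_rpow_re_of_pos hx.1, e,
    Complex.norm_cpow_eq_rpow_re_of_pos h1]
  simp

/-- An exponent below `1` keeps `x ^ (-γ)` integrable at `0`; a nonnegative one makes `t ^ γ`
monotone in `t`. -/
theorem RegVar.upper_nonneg {β : ℝ} {g : ℕ → ℝ} (h : RegVar β g) (hβ : β < 1) :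
    ∃ γ C : ℝ, 0 ≤ γ ∧ γ < 1 ∧ 0 < C ∧
      ∀ m n : ℕ, 1 ≤ m → m ≤ n → g m ≤ C * g n * ((n : ℝ) / m) ^ γ := by
  obtain ⟨γ, h1, h2⟩ := exists_between (max_lt hβ one_pos : max β 0 < 1)
  obtain ⟨C, hC⟩ := h.upper γ ((le_max_left _ _).trans_lt h1)
  refine ⟨γ, C, ((le_max_right _ _).trans_lt h1).le, h2, ?_, hC⟩
  have := hC 1 1 le_rfl le_rfl
  have h3 := h.pos 1 le_rfl
  simp at this
  by_contra hneg
  nlinarith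

theorem RegVar.tendsto_zero {β : ℝ} {g : ℕ → ℝ} (h : RegVar β g) (hβ : 0 < β) :
    Tendsto g atTop (𝓝 0) := by
  obtain ⟨C, hC⟩ := h.lower (β / 2) (by linarith)
  have h1 : Tendsto (fun n : ℕ => C * g 1 * ((n : ℝ) / (1 : ℕ)) ^ (-(β / 2))) atTop
      (𝓝 (C * g 1 * 0)) := by
    refine Tendsto.const_mul _ ?_
    simp only [Nat.cast_one, div_one]
    exact (tendsto_rpow_neg_atTop (by linarith)).comp tendsto_natCast_atTop_atTop
  rw [mul_zero] at h1
  refine squeeze_zero' ?_ ?_ h1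
  · filter_upwards [eventually_ge_atTop 1] with n hn using (h.pos n hn).le
  · filter_upwards [eventually_ge_atTop 1] with n hn using hC 1 n le_rfl hn

theorem tendsto_floor_mul_div {x : ℝ} (hx : 0 ≤ x) :
    Tendsto (fun n : ℕ => (⌊(n : ℝ) * x⌋₊ : ℝ) / n) atTop (𝓝 x) := by
  have := (tendsto_nat_floor_mul_div_atTop (R := ℝ) hx).comp tendsto_natCast_atTop_atTop
  refine this.congr fun n => ?_
  simp [mul_comm]

theorem div_floor_rpow_le {γ x : ℝ} (hγ : 0 ≤ γ) (hx : 0 < x) {n k : ℕ}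
    (hk : 1 ≤ k) (hkx : k = ⌊(n : ℝ) * x⌋₊) :
    ((n : ℝ) / k) ^ γ ≤ 2 ^ γ * x ^ (-γ) := by
  have hk0 : (1 : ℝ) ≤ k := by exact_mod_cast hk
  have h1 : (n : ℝ) * x < k + 1 := by rw [hkx]; exact Nat.lt_floor_add_one _
  rw [Real.rpow_neg hx.le, ← div_eq_mul_inv, ← Real.div_rpow (by norm_num) hx.le]
  refine Real.rpow_le_rpow (by positivity) ?_ hγ
  rw [div_le_div_iff₀ (by positivity) hx]
  linarith

/-- The quotient is a Riemann sum for `c x ^ (-α) (1 - x) ^ (-β)` on `(0, 1)`, and the Potter bounds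
supply a beta integrand as majorant. The weight `e` allows for a first factor that is only
asymptotically proportional to `a`. -/
theorem RegVar.tendsto_conv {α β : ℝ} {a b : ℕ → ℝ} (ha : RegVar α a) (hb : RegVar β b)
    (hα : α < 1) (hβ : β < 1) {e : ℕ → ℝ} {c : ℝ} (he : Tendsto e atTop (𝓝 c)) :
    Tendsto (fun n : ℕ => (∑ k ∈ Finset.Ico 1 n, e k * a k * b (n - k)) / (n * a n * b n)) atTop
      (𝓝 (c * (Real.Gamma (1 - α) * Real.Gamma (1 - β) / Real.Gamma (1 - α + (1 - β))))) := by
  obtain ⟨γ, C, hγ0, hγ1, hC, hab⟩ := ha.upper_nonneg hα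
  obtain ⟨γ', C', hγ0', hγ1', hC', hbb⟩ := hb.upper_nonneg hβ
  obtain ⟨D, hD⟩ := he.norm.bddAbove_range
  have hD' : ∀ k, |e k| ≤ D := fun k => hD ⟨k, rfl⟩
  have hD0 : 0 ≤ D := (abs_nonneg _).trans (hD' 0)
  have key := tendsto_riemann_sum (M := 1)
    (H := fun n k => e k * (a k / a n) * (b (n - k) / b n))
    (h := fun x => c * (x ^ (-α)) * ((1 - x) ^ (-β)))
    (b := fun x => D * (C * 2 ^ γ) * C' * (x ^ ((1 - γ) - 1) * (1 - x) ^ ((1 - γ') - 1)))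
    ?_ ?_ ?_ ?_
  · have e1 : ∫ x in (0 : ℝ)..(1 : ℕ), c * (x ^ (-α)) * ((1 - x) ^ (-β))
        = c * (Real.Gamma (1 - α) * Real.Gamma (1 - β) / Real.Gamma (1 - α + (1 - β))) := by
      rw [← integral_beta (by linarith) (by linarith), ← intervalIntegral.integral_const_mul,
        Nat.cast_one]
      refine intervalIntegral.integral_congr fun x _ => ?_
      rw [mul_assoc]
      congr 4 <;> ring
    rw [e1] at key
    refine key.congr fun n => ?_
    rw [mul_one, smul_eq_mul, div_eq_inv_mul, mul_inv, mul_inv, mul_assoc, mul_assoc]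
    congr 1
    rw [Finset.mul_sum, Finset.mul_sum]
    refine Finset.sum_congr rfl fun k _ => ?_
    ring
  · simp only [Nat.cast_one]
    exact (integrableOn_beta (by linarith) (by linarith)).const_mul _
  · intro x hx
    have h1 : (0 : ℝ) < x := hx.1
    have h2 : (0 : ℝ) < 1 - x := by have := hx.2; simp at this; linarith
    positivity
  · intro n k x hx hn hk hkx
    have hx0 : (0 : ℝ) < x := hx.1
    have hx1 : (0 : ℝ) < 1 - x := by have := hx.2; simp at this; linarith
    have hn0 : (0 : ℝ) < n := by exact_mod_cast hn
    have hkn' : (k : ℝ) ≤ n * x := by rw [hkx]; exact Nat.floor_le (by positivity)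
    have hkn : k < n := by
      have : (k : ℝ) < n := by nlinarith
      exact_mod_cast this
    have han := ha.pos n hn
    have hbn := hb.pos n hn
    have hak := ha.pos k hk
    have hbk := hb.pos (n - k) (by omega)
    have h1 : a k / a n ≤ C * 2 ^ γ * x ^ (-γ) := by
      rw [div_le_iff₀ han]
      refine (hab k n hk hkn.le).trans ?_
      have := div_floor_rpow_le hγ0 hx0 hk hkx
      calc C * a n * ((n : ℝ) / k) ^ γ ≤ C * a n * (2 ^ γ * x ^ (-γ)) := by gcongr
        _ = _ := by ring
    have h2 : b (n - k) / b n ≤ C' * (1 - x) ^ (-γ') := by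
      rw [div_le_iff₀ hbn]
      refine (hbb (n - k) n (by omega) (Nat.sub_le _ _)).trans ?_
      have : ((n : ℝ) / (n - k : ℕ)) ^ γ' ≤ (1 - x) ^ (-γ') := by
        rw [Real.rpow_neg hx1.le, ← Real.inv_rpow hx1.le]
        refine Real.rpow_le_rpow (by positivity) ?_ hγ0'
        have hnk : (0 : ℝ) < (n - k : ℕ) := by
          rw [Nat.cast_pos]; omega
        rw [inv_eq_one_div, div_le_div_iff₀ hnk hx1, Nat.cast_sub hkn.le]
        linarith
      calc C' * b n * ((n : ℝ) / (n - k : ℕ)) ^ γ' ≤ C' * b n * (1 - x) ^ (-γ') := by gcongr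
        _ = _ := by ring
    rw [norm_mul, norm_mul, Real.norm_eq_abs, Real.norm_eq_abs, Real.norm_eq_abs,
      abs_of_pos (div_pos hak han), abs_of_pos (div_pos hbk hbn)]
    calc |e k| * (a k / a n) * (b (n - k) / b n)
        ≤ D * (C * 2 ^ γ * x ^ (-γ)) * (C' * (1 - x) ^ (-γ')) := by
          gcongr
          exact hD' k
      _ = D * (C * 2 ^ γ) * C' * (x ^ ((1 - γ) - 1) * (1 - x) ^ ((1 - γ') - 1)) := by
          rw [show (1 - γ) - 1 = -γ by ring, show (1 - γ') - 1 = -γ' by ring]; ring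
  · intro x hx
    have hx0 : (0 : ℝ) < x := hx.1
    have hx1 : x < 1 := by have := hx.2; simpa using this
    have hfl := tendsto_floor_mul_div hx0.le
    have h1 : Tendsto (fun n : ℕ => ⌊(n : ℝ) * x⌋₊) atTop atTop :=
      tendsto_nat_floor_atTop.comp (tendsto_natCast_atTop_atTop.atTop_mul_const hx0)
    refine ((he.comp h1).mul (ha.ratio x hx0 _ hfl)).mul (hb.ratio (1 - x) (by linarith) _ ?_)
    refine ((tendsto_const_nhds (x := (1 : ℝ))).sub hfl).congr' ?_
    filter_upwards [eventually_ge_atTop 1] with n hn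
    have hn0 : (0 : ℝ) < n := by exact_mod_cast hn
    have : ⌊(n : ℝ) * x⌋₊ ≤ n := Nat.floor_le_of_le (by nlinarith)
    rw [Nat.cast_sub this]
    field_simp

/-- Convolution of `u` with `u k ~ c / (k g k)` against the regularly varying sequence `g`. -/
theorem RegVar.tendsto_renewal_conv {β c : ℝ} {g u : ℕ → ℝ} (hg : RegVar β g) (hβ0 : 0 < β)
    (hβ1 : β < 1) (hu : Tendsto (fun n : ℕ => n * g n * u n) atTop (𝓝 c)) :
    Tendsto (fun n : ℕ => ∑ k ∈ Finset.range (n + 1), u k * g (n - k)) atTop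
      (𝓝 (c * (Real.Gamma β * Real.Gamma (1 - β)))) := by
  -- `tendsto_conv` is applied with `a k = 1 / (k g k)` and weight `e k = k g k u k → c`. Then `n
  -- a_n g_n = 1`, and the Gamma factor in the denominator is `Γ(1)`.
  have ha : RegVar (1 - β) (fun n : ℕ => ((n : ℝ) * g n)⁻¹) :=
    (((RegVar.rpow 1).mul hg).inv).congr (by ring) (fun n _ => by simp)
  have h1 := ha.tendsto_conv hg (by linarith) hβ1 hu
  have h2 : Tendsto u atTop (𝓝 0) := by
    have := hu.mul (ha.tendsto_zero (by linarith))
    rw [mul_zero] at this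
    refine this.congr' ?_
    filter_upwards [eventually_ge_atTop 1] with n hn
    have hn0 : (0 : ℝ) < n := by exact_mod_cast hn
    have := hg.pos n hn
    field_simp
  -- The terms `k = 0` and `k = n`, absent from `tendsto_conv`, vanish in the limit.
  have h3 := (h1.add ((hg.tendsto_zero hβ0).const_mul (u 0))).add (h2.mul_const (g 0))
  simp only [mul_zero, zero_mul, add_zero, sub_sub_cancel, show β + (1 - β) = 1 by ring,
    Real.Gamma_one, div_one] at h3
  refine h3.congr' ?_
  filter_upwards [eventually_ge_atTop 1] with n hn
  have hn0 : (0 : ℝ) < n := by exact_mod_cast hn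
  have hgn := hg.pos n hn
  rw [Finset.sum_range_succ, Finset.range_eq_Ico, Finset.sum_eq_sum_Ico_succ_bot hn]
  have e1 : (n : ℝ) * (n * g n)⁻¹ * g n = 1 := by field_simp
  rw [e1, div_one, Nat.sub_self, Nat.sub_zero, zero_add, add_comm (u 0 * g n)]
  congr 2
  refine Finset.sum_congr rfl fun k hk => ?_
  have hk1 := (Finset.mem_Ico.1 hk).1
  have hk0 : (0 : ℝ) < k := by exact_mod_cast hk1
  have hgk := hg.pos k hk1
  field_simp

/-- Karamata's theorem for the partial sums of a regularly varying sequence. -/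
theorem RegVar.tendsto_sum {β : ℝ} {g : ℕ → ℝ} (hg : RegVar β g) (hβ1 : β < 1) :
    Tendsto (fun n : ℕ => (∑ k ∈ Finset.range (n + 1), g k) / (n * g n)) atTop
      (𝓝 (1 - β)⁻¹) := by
  -- A partial sum is a convolution with the constant `1`, and `Γ(1 - β) / Γ(2 - β) = 1 / (1 - β)`.
  have h1 := hg.tendsto_conv RegVar.one hβ1 one_pos (tendsto_const_nhds (x := (1 : ℝ)))
  have hz : RegVar (1 - β) (fun n : ℕ => ((n : ℝ) * g n)⁻¹) :=
    (((RegVar.rpow 1).mul hg).inv).congr (by ring) (fun n _ => by simp)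
  have h2 := (hz.tendsto_zero (by linarith)).const_mul (g 0)
  have h3 : Tendsto (fun n : ℕ => ((n : ℝ))⁻¹) atTop (𝓝 0) :=
    tendsto_inv_atTop_zero.comp tendsto_natCast_atTop_atTop
  have h4 := (h1.add h2).add h3
  simp only [mul_zero, add_zero, sub_zero, Real.Gamma_one, mul_one, one_mul,
    Real.Gamma_add_one (show 1 - β ≠ 0 by linarith)] at h4
  have e : Real.Gamma (1 - β) / ((1 - β) * Real.Gamma (1 - β)) = (1 - β)⁻¹ := by
    have := (Real.Gamma_pos_of_pos (show 0 < 1 - β by linarith)).ne'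
    have h5 : 1 - β ≠ 0 := by linarith
    field_simp
  rw [e] at h4
  refine h4.congr' ?_
  filter_upwards [eventually_ge_atTop 1] with n hn
  have hn0 : (0 : ℝ) < n := by exact_mod_cast hn
  have hgn := hg.pos n hn
  rw [Finset.sum_range_succ, Finset.range_eq_Ico, Finset.sum_eq_sum_Ico_succ_bot hn]
  field_simp
  ring

end Renewal

/-! ### The Tauberian step: from renewal masses to the tail. -/

namespace Renewal

theorem coeff_mk_mul_mk (a b : ℕ → ℝ) (n : ℕ) :
    PowerSeries.coeff n (PowerSeries.mk a * PowerSeries.mk b)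
      = ∑ k ∈ Finset.range (n + 1), a k * b (n - k) := by
  rw [PowerSeries.coeff_mul, Finset.Nat.sum_antidiagonal_eq_sum_range_succ_mk]
  simp

/-- Convolution averages of a convergent sequence. -/
theorem exists_conv_bound {F w : ℕ → ℝ} {B : ℝ} (hF0 : ∀ n, 0 ≤ F n) (hF1 : ∀ n, F n ≤ 1)
    (hw : Tendsto w atTop (𝓝 B)) {ε : ℝ} (hε : 0 < ε) :
    ∃ K, ∀ n : ℕ, |(∑ k ∈ Finset.range (n + 1), F k * w (n - k))
      - B * ∑ k ∈ Finset.range (n + 1), F k| ≤ ε * (∑ k ∈ Finset.range (n + 1), F k) + K := by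
  have hz : Tendsto (fun n => w n - B) atTop (𝓝 0) := by
    simpa using hw.sub_const B
  obtain ⟨N, hN⟩ := Metric.tendsto_atTop.1 hz ε hε
  -- Where `w` is not yet within `ε` of `B`, the bound `F ≤ 1` leaves a total error independent of
  -- `n`.
  refine ⟨∑ j ∈ Finset.range N, |w j - B|, fun n => ?_⟩
  have e : (∑ k ∈ Finset.range (n + 1), F k * w (n - k)) - B * ∑ k ∈ Finset.range (n + 1), F k
      = ∑ k ∈ Finset.range (n + 1), F k * (w (n - k) - B) := by
    rw [Finset.mul_sum, ← Finset.sum_sub_distrib]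
    exact Finset.sum_congr rfl fun k _ => by ring
  rw [e]
  refine (Finset.abs_sum_le_sum_abs _ _).trans ?_
  have h1 : ∀ k ∈ Finset.range (n + 1), |F k * (w (n - k) - B)|
      ≤ ε * F k + if n - k < N then |w (n - k) - B| else 0 := by
    intro k _
    rw [abs_mul, abs_of_nonneg (hF0 k)]
    split_ifs with h
    · have : F k * |w (n - k) - B| ≤ 1 * |w (n - k) - B| := by
        gcongr; exact hF1 k
      have := mul_nonneg hε.le (hF0 k)
      linarith
    · have := hN (n - k) (not_lt.1 h)
      rw [Real.dist_eq, sub_zero] at this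
      rw [add_zero, mul_comm ε]
      exact mul_le_mul_of_nonneg_left this.le (hF0 k)
  refine (Finset.sum_le_sum h1).trans ?_
  rw [Finset.sum_add_distrib, ← Finset.mul_sum]
  gcongr
  have e2 := Finset.sum_range_reflect (fun j => if j < N then |w j - B| else 0) (n + 1)
  simp only [Nat.add_sub_cancel] at e2
  rw [e2, ← Finset.sum_filter]
  refine Finset.sum_le_sum_of_subset_of_nonneg (fun j hj => ?_) fun _ _ _ => abs_nonneg _
  exact Finset.mem_range.2 (Finset.mem_filter.1 hj).2

theorem tendsto_slope_rpow (s A : ℝ) :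
    Tendsto (fun x : ℝ => (A * x ^ s - A) / (x - 1)) (𝓝[≠] 1) (𝓝 (A * s)) := by
  have h := ((Real.hasDerivAt_rpow_const (x := 1) (p := s) (Or.inl one_ne_zero)).const_mul
    A).tendsto_slope
  rw [Real.one_rpow, mul_one] at h
  refine h.congr fun x => ?_
  rw [slope_def_field, Real.one_rpow, mul_one]

/-- The monotone density theorem for sequences. -/
theorem RegVar.tendsto_of_tendsto_sum {β A : ℝ} {g F : ℕ → ℝ} (hg : RegVar β g)
    (hF : Antitone F)
    (h : Tendsto (fun n : ℕ => (∑ k ∈ Finset.range (n + 1), F k) / (n * g n)) atTop (𝓝 A)) :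
    Tendsto (fun n => F n / g n) atTop (𝓝 (A * (1 - β))) := by
  set Φ : ℕ → ℝ := fun n => ∑ k ∈ Finset.range (n + 1), F k with hΦ
  have hD : RegVar (β - 1) (fun n : ℕ => (n : ℝ) * g n) :=
    ((RegVar.rpow 1).mul hg).congr (by ring) (fun n _ => by simp)
  have hfl : ∀ x : ℝ, 0 < x → Tendsto (fun n : ℕ => (Φ ⌊(n : ℝ) * x⌋₊ - Φ n) / (n * g n)
      / ((⌊(n : ℝ) * x⌋₊ : ℝ) / n - 1)) atTop (𝓝 ((A * x ^ (1 - β) - A) / (x - 1))) ∨ x = 1 := by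
    intro x hx
    by_cases hx1 : x = 1
    · exact Or.inr hx1
    left
    have h1 := tendsto_floor_mul_div hx.le
    have h2 : Tendsto (fun n : ℕ => ⌊(n : ℝ) * x⌋₊) atTop atTop :=
      tendsto_nat_floor_atTop.comp (tendsto_natCast_atTop_atTop.atTop_mul_const hx)
    refine Tendsto.div ?_ (h1.sub_const 1) (sub_ne_zero.2 hx1)
    have h3 := (h.comp h2).mul (hD.ratio x hx _ h1)
    rw [neg_sub] at h3
    refine (h3.sub h).congr' ?_
    filter_upwards [eventually_ge_atTop 1, h2.eventually_ge_atTop 1] with n hn hk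
    have hn0 : (0 : ℝ) < n := by exact_mod_cast hn
    have hk0 : (0 : ℝ) < (⌊(n : ℝ) * x⌋₊ : ℝ) := by exact_mod_cast hk
    have := hg.pos n hn
    have := hg.pos _ hk
    simp only [Function.comp]
    field_simp
    rfl
  have hup : ∀ n k : ℕ, n ≤ k → Φ k - Φ n ≤ (k - n : ℝ) * F n := by
    intro n k hnk
    induction k, hnk using Nat.le_induction with
    | base => simp
    | succ k hk ih =>
      have : Φ (k + 1) = Φ k + F (k + 1) := Finset.sum_range_succ _ _
      have h2 := hF (show n ≤ k + 1 by omega)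
      rw [this]; push_cast
      linarith
  have hdn : ∀ n k : ℕ, k ≤ n → (n - k : ℝ) * F n ≤ Φ n - Φ k := by
    intro n k hkn
    have : ∀ j, k ≤ j → j ≤ n → (j - k : ℝ) * F n ≤ Φ j - Φ k := by
      intro j hkj
      induction j, hkj using Nat.le_induction with
      | base => intro _; simp
      | succ j hj ih =>
        intro hjn
        have e : Φ (j + 1) = Φ j + F (j + 1) := Finset.sum_range_succ _ _
        have h2 := hF hjn
        have h3 := ih (by omega)
        rw [e]; push_cast
        linarith
    exact this n hkn le_rfl
  have hs := tendsto_slope_rpow (1 - β) A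
  -- First `n → ∞` at fixed `x ≠ 1`, then `x → 1`, where the slope of `A x ^ (1 - β)` tends to `A (1
  -- - β)`. Increments to the right of `n` bound `F n` from below, those to the left from above.
  refine tendsto_order.2 ⟨fun a ha => ?_, fun a ha => ?_⟩
  · have h1 : ∀ᶠ x in 𝓝[>] (1 : ℝ), a < (A * x ^ (1 - β) - A) / (x - 1) ∧ 1 < x :=
      (hs.mono_left (nhdsWithin_mono _ fun x (hx : 1 < x) => hx.ne')).eventually
        (lt_mem_nhds ha) |>.and self_mem_nhdsWithin
    obtain ⟨x, hx, hx1⟩ := h1.exists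
    have h2 := (hfl x (by linarith)).resolve_right hx1.ne'
    filter_upwards [h2.eventually (lt_mem_nhds hx), eventually_ge_atTop 1,
      (tendsto_floor_mul_div (x := x) (by linarith)).eventually (lt_mem_nhds hx1)] with n h3 hn h4
    have hn0 : (0 : ℝ) < n := by exact_mod_cast hn
    have hgn := hg.pos n hn
    refine h3.trans_le ?_
    rw [lt_div_iff₀ hn0, one_mul] at h4
    have h5 := hup n _ (by exact_mod_cast h4.le)
    rw [div_div, div_le_div_iff₀ _ hgn]
    · have e : (n : ℝ) * g n * ((⌊(n : ℝ) * x⌋₊ : ℝ) / n - 1) = g n * (⌊(n : ℝ) * x⌋₊ - n) := by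
        field_simp
      rw [e]
      calc _ ≤ ((⌊(n : ℝ) * x⌋₊ : ℝ) - n) * F n * g n := by gcongr
        _ = _ := by ring
    · have : (0 : ℝ) < (⌊(n : ℝ) * x⌋₊ : ℝ) / n - 1 := by
        rw [sub_pos, lt_div_iff₀ hn0]; linarith
      positivity
  · have h1 : ∀ᶠ x in 𝓝[<] (1 : ℝ), (A * x ^ (1 - β) - A) / (x - 1) < a ∧ x ∈ Set.Ioo 0 1 :=
      (hs.mono_left (nhdsWithin_mono _ fun x (hx : x < 1) => hx.ne)).eventually
        (gt_mem_nhds ha) |>.and (Ioo_mem_nhdsLT one_pos)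
    obtain ⟨x, hx, hx0, hx1⟩ := h1.exists
    have h2 := (hfl x hx0).resolve_right hx1.ne
    filter_upwards [h2.eventually (gt_mem_nhds hx), eventually_ge_atTop 1,
      (tendsto_floor_mul_div (x := x) (by linarith)).eventually (gt_mem_nhds hx1)] with n h3 hn h4
    have hn0 : (0 : ℝ) < n := by exact_mod_cast hn
    have hgn := hg.pos n hn
    refine lt_of_le_of_lt ?_ h3
    have h6 : (0 : ℝ) < 1 - (⌊(n : ℝ) * x⌋₊ : ℝ) / n := by linarith
    rw [div_lt_iff₀ hn0, one_mul] at h4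
    have h5 := hdn n _ (by exact_mod_cast h4.le)
    rw [← neg_sub (Φ n), ← neg_sub (1 : ℝ), neg_div, neg_div_neg_eq, div_div,
      div_le_div_iff₀ hgn (by positivity)]
    have e : (n : ℝ) * g n * (1 - (⌊(n : ℝ) * x⌋₊ : ℝ) / n) = g n * (n - ⌊(n : ℝ) * x⌋₊) := by
      field_simp
    rw [e]
    calc _ = ((n : ℝ) - (⌊(n : ℝ) * x⌋₊ : ℝ)) * F n * g n := by ring
      _ ≤ _ := by gcongr

/-- If the renewal masses `u` are regularly varying, then so is the tail `F` of the
inter-renewal law. -/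
theorem RegVar.tendsto_tail {β : ℝ} {g u F : ℕ → ℝ} (hg : RegVar β g) (hβ0 : 0 < β)
    (hβ1 : β < 1) (hu : Tendsto (fun n : ℕ => n * g n * u n) atTop (𝓝 1))
    (hF : Antitone F) (hF0 : ∀ n, 0 ≤ F n) (hF1 : ∀ n, F n ≤ 1)
    (hconv : ∀ n, ∑ k ∈ Finset.range (n + 1), u k * F (n - k) = 1) :
    Tendsto (fun n => F n / g n) atTop (𝓝 (Real.Gamma β * Real.Gamma (1 - β))⁻¹) := by
  set B := Real.Gamma β * Real.Gamma (1 - β) with hB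
  have hB0 : 0 < B := mul_pos (Real.Gamma_pos_of_pos hβ0) (Real.Gamma_pos_of_pos (by linarith))
  set w : ℕ → ℝ := fun n => ∑ k ∈ Finset.range (n + 1), u k * g (n - k) with hw
  have hwB : Tendsto w atTop (𝓝 B) := by
    have := hg.tendsto_renewal_conv hβ0 hβ1 hu
    rwa [one_mul] at this
  set G : ℕ → ℝ := fun n => ∑ k ∈ Finset.range (n + 1), g k with hG
  set Φ : ℕ → ℝ := fun n => ∑ k ∈ Finset.range (n + 1), F k with hΦ
  -- Associativity: `F ∗ (u ∗ g) = (u ∗ F) ∗ g = 1 ∗ g`.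
  have hGeq : ∀ n, ∑ k ∈ Finset.range (n + 1), F k * w (n - k) = G n := by
    intro n
    have h1 : PowerSeries.mk u * PowerSeries.mk F = PowerSeries.mk (fun _ => (1 : ℝ)) := by
      ext n; rw [coeff_mk_mul_mk, hconv, PowerSeries.coeff_mk]
    have h2 : PowerSeries.mk u * PowerSeries.mk g = PowerSeries.mk w := by
      ext n; rw [coeff_mk_mul_mk, PowerSeries.coeff_mk]
    rw [← coeff_mk_mul_mk, ← h2, ← mul_assoc, mul_comm (PowerSeries.mk F), h1, mul_comm,
      coeff_mk_mul_mk]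
    simp [hG]
  have hΦ0 : ∀ n, 0 ≤ Φ n := fun n => Finset.sum_nonneg fun k _ => hF0 k
  have hGD : Tendsto (fun n : ℕ => G n / (n * g n)) atTop (𝓝 (1 - β)⁻¹) := hg.tendsto_sum hβ1
  have hz : RegVar (1 - β) (fun n : ℕ => ((n : ℝ) * g n)⁻¹) :=
    (((RegVar.rpow 1).mul hg).inv).congr (by ring) (fun n _ => by simp)
  have hDtop : Tendsto (fun n : ℕ => (n : ℝ) * g n) atTop atTop := by
    have h0 := hz.tendsto_zero (by linarith)
    have h1 : Tendsto (fun n : ℕ => ((n : ℝ) * g n)⁻¹) atTop (𝓝[>] 0) :=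
      tendsto_nhdsWithin_iff.2 ⟨h0, by
        filter_upwards [eventually_ge_atTop 1] with n hn using hz.pos n hn⟩
    exact h1.inv_tendsto_nhdsGT_zero.congr fun n => inv_inv _
  have hGtop : Tendsto G atTop atTop := by
    have := hGD.pos_mul_atTop (inv_pos.2 (by linarith)) hDtop
    refine this.congr' ?_
    filter_upwards [eventually_ge_atTop 1] with n hn
    have hn0 : (0 : ℝ) < n := by exact_mod_cast hn
    have := hg.pos n hn
    field_simp
  -- As `w → B`, the sums `G` and `B * Φ` differ by at most `ε * Φ + K`. With `ε = 1` this forces `Φ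
  -- → ∞`; then `K` is negligible and `G / Φ → B`.
  have hb := fun ε hε => exists_conv_bound hF0 hF1 hwB (ε := ε) hε
  simp only [hGeq] at hb
  have hΦtop : Tendsto Φ atTop atTop := by
    obtain ⟨K, hK⟩ := hb 1 one_pos
    have h1 : Tendsto (fun n => (G n + -K) / (B + 1)) atTop atTop :=
      (tendsto_atTop_add_const_right _ _ hGtop).atTop_div_const (by linarith)
    refine tendsto_atTop_mono (fun n => ?_) h1
    rw [div_le_iff₀ (by linarith)]
    have := (abs_le.1 (hK n)).2
    change _ ≤ (∑ k ∈ Finset.range (n + 1), F k) * (B + 1)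
    linarith
  have hratio : Tendsto (fun n => G n / Φ n) atTop (𝓝 B) := by
    rw [Metric.tendsto_atTop']
    intro ε hε
    obtain ⟨K, hK⟩ := hb (ε / 2) (by linarith)
    obtain ⟨N, hN⟩ := eventually_atTop.1 (hΦtop.eventually_gt_atTop (max 0 (2 * K / ε)))
    refine ⟨N, fun n hn => ?_⟩
    have h1 := hN n hn.le
    have h2 : 0 < Φ n := (le_max_left _ _).trans_lt h1
    have h3 : 2 * K / ε < Φ n := (le_max_right _ _).trans_lt h1
    rw [div_lt_iff₀ hε] at h3
    rw [Real.dist_eq, div_sub' h2.ne', abs_div, abs_of_pos h2, div_lt_iff₀ h2, mul_comm (Φ n) B]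
    refine (hK n).trans_lt ?_
    change ε / 2 * Φ n + K < ε * Φ n
    linarith
  have hfin : Tendsto (fun n : ℕ => Φ n / (n * g n)) atTop (𝓝 ((1 - β)⁻¹ / B)) := by
    refine (hGD.div hratio hB0.ne').congr' ?_
    filter_upwards [eventually_ge_atTop 1, hΦtop.eventually_gt_atTop 0,
      hGtop.eventually_gt_atTop 0] with n hn h1 h2
    have hn0 : (0 : ℝ) < n := by exact_mod_cast hn
    have := hg.pos n hn
    simp only [Pi.div_apply]
    field_simp
  have := hg.tendsto_of_tendsto_sum hF hfin
  have e : (1 - β)⁻¹ / B * (1 - β) = B⁻¹ := by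
    have : 1 - β ≠ 0 := by linarith
    field_simp
  rwa [e] at this

end Renewal

/-! ### Generating functions and the contribution of few renewals. -/

namespace Renewal
open PowerSeries

/-- A real power series with nonnegative coefficients. -/
def CoeffNonneg (A : PowerSeries ℝ) : Prop := ∀ n, 0 ≤ coeff n A

namespace CoeffNonneg
variable {A B : PowerSeries ℝ}

theorem one : CoeffNonneg 1 := fun n => by
  rw [coeff_one]; split_ifs <;> norm_num

theorem add (hA : CoeffNonneg A) (hB : CoeffNonneg B) : CoeffNonneg (A + B) := fun n => by
  rw [map_add]; exact add_nonneg (hA n) (hB n)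

theorem mul (hA : CoeffNonneg A) (hB : CoeffNonneg B) : CoeffNonneg (A * B) := fun n => by
  rw [coeff_mul]; exact Finset.sum_nonneg fun x _ => mul_nonneg (hA _) (hB _)

theorem pow (hA : CoeffNonneg A) : ∀ k : ℕ, CoeffNonneg (A ^ k)
  | 0 => by rw [pow_zero]; exact one
  | k + 1 => by rw [pow_succ]; exact (hA.pow k).mul hA

theorem const {c : ℝ} (hc : 0 ≤ c) : CoeffNonneg (C c) := fun n => by
  rw [coeff_C]; split_ifs <;> simp [hc]

/-- Positivity of the solution of a renewal equation. -/
theorem of_mul_sub {P : PowerSeries ℝ} {c : ℝ} (hc : 0 < c) (hP : CoeffNonneg P)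
    (hP0 : coeff 0 P = 0) (hB : CoeffNonneg B) (h : A * (C c - P) = B) : CoeffNonneg A := by
  have h' : C c * A = B + P * A := by rw [← h]; ring
  intro n
  induction n using Nat.strong_induction_on with
  | _ n ih =>
    have h1 := congrArg (coeff n) h'
    rw [coeff_C_mul, map_add, coeff_mul] at h1
    have h2 : 0 ≤ ∑ x ∈ Finset.HasAntidiagonal.antidiagonal n, coeff x.1 P * coeff x.2 A := by
      refine Finset.sum_nonneg fun x hx => ?_
      rw [Finset.HasAntidiagonal.mem_antidiagonal] at hx
      rcases Nat.eq_zero_or_pos x.1 with h0 | h0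
      · rw [h0, hP0, zero_mul]
      · exact mul_nonneg (hP _) (ih _ (by omega))
    have h3 := hB n
    by_contra hneg
    have := mul_neg_of_pos_of_neg hc (not_le.1 hneg)
    linarith

end CoeffNonneg

theorem coeff_X_mul_derivative (A : PowerSeries ℝ) (n : ℕ) :
    coeff n (X * derivative ℝ A) = n * coeff n A := by
  cases n with
  | zero => simp
  | succ n => rw [coeff_succ_X_mul, coeff_derivative]; push_cast; ring

/-- The power series data attached to a renewal sequence: `P` is the generating function of the
inter-renewal law, `F` that of its tail, and `U` that of the renewal masses. -/
structure RenewalSeries (P F U : PowerSeries ℝ) : Prop where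
  nonneg_P : CoeffNonneg P
  nonneg_F : CoeffNonneg F
  coeff_zero_P : coeff 0 P = 0
  one_sub_P : 1 - P = (1 - X) * F
  mul_one_sub : U * (1 - P) = 1

/-- Used with `c = 1 + ε`: the series `V = ∑ P ^ k / (1 + ε) ^ (k + 1)` discounts the number of
renewals and, unlike the renewal series itself, has summable coefficients. -/
theorem exists_mul_C_sub {P : PowerSeries ℝ} (hP0 : coeff 0 P = 0) {c : ℝ} (hc : 0 < c) :
    ∃ V : PowerSeries ℝ, V * (C c - P) = 1 := by
  refine ⟨(C c - P)⁻¹, PowerSeries.inv_mul_cancel _ ?_⟩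
  rw [map_sub, ← coeff_zero_eq_constantCoeff_apply P, hP0]
  simpa using hc.ne'

namespace RenewalSeries
variable {P F U V : PowerSeries ℝ} {ε : ℝ}

theorem nonneg_U (h : RenewalSeries P F U) : CoeffNonneg U :=
  CoeffNonneg.of_mul_sub one_pos h.nonneg_P h.coeff_zero_P CoeffNonneg.one
    (by rw [map_one]; exact h.mul_one_sub)

theorem mul_F (h : RenewalSeries P F U) : U * F = PowerSeries.mk 1 := by
  have h1 := h.mul_one_sub
  rw [h.one_sub_P] at h1
  calc U * F = U * F * (PowerSeries.mk 1 * (1 - X)) := by rw [mk_one_mul_one_sub_eq_one, mul_one]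
    _ = PowerSeries.mk 1 * (U * ((1 - X) * F)) := by ring
    _ = PowerSeries.mk 1 := by rw [h1, mul_one]

theorem nonneg_V (h : RenewalSeries P F U) (hε : 0 ≤ ε) (hV : V * (C (1 + ε) - P) = 1) :
    CoeffNonneg V :=
  CoeffNonneg.of_mul_sub (by linarith) h.nonneg_P h.coeff_zero_P CoeffNonneg.one hV

theorem V_mul_one_sub (hV : V * (C (1 + ε) - P) = 1) : V * (1 - P) = 1 - C ε * V := by
  rw [map_add, map_one] at hV
  linear_combination hV

/-- The resolvent identity for `1 / (1 - P)` and `1 / (1 + ε - P)`. -/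
theorem U_eq (h : RenewalSeries P F U) (hV : V * (C (1 + ε) - P) = 1) :
    U = V + C ε * U * V := by
  have h1 := V_mul_one_sub hV
  have h2 := h.mul_one_sub
  linear_combination (-U) * h1 + V * h2

theorem nonneg_U_sub_V (h : RenewalSeries P F U) (hε : 0 ≤ ε) (hV : V * (C (1 + ε) - P) = 1) :
    CoeffNonneg (U - V) := by
  have : U - V = C ε * U * V := by linear_combination h.U_eq hV
  rw [this]
  exact ((CoeffNonneg.const hε).mul h.nonneg_U).mul (h.nonneg_V hε hV)

/-- Multiplication by `mk 1 = 1 / (1 - X)` takes partial sums, so this bounds those of `V` by `1 /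
ε`. The difference is exactly `ε⁻¹ V F`. -/
theorem nonneg_sum_sub (h : RenewalSeries P F U) (hε : 0 < ε) (hV : V * (C (1 + ε) - P) = 1) :
    CoeffNonneg (C ε⁻¹ * PowerSeries.mk 1 - V * PowerSeries.mk 1) := by
  have h1 := V_mul_one_sub hV
  rw [h.one_sub_P] at h1
  have h2 : (PowerSeries.mk 1 : PowerSeries ℝ) * (1 - X) = 1 := mk_one_mul_one_sub_eq_one ℝ
  have h3 : (C ε⁻¹ : PowerSeries ℝ) * C ε = 1 := by
    rw [← map_mul, inv_mul_cancel₀ hε.ne', map_one]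
  have e : C ε⁻¹ * PowerSeries.mk 1 - V * PowerSeries.mk 1 = C ε⁻¹ * (V * F) := by
    linear_combination (-C ε⁻¹ * PowerSeries.mk 1) * h1 + (C ε⁻¹ * V * F) * h2 + V * PowerSeries.mk 1 * h3
  rw [e]
  exact (CoeffNonneg.const (inv_pos.2 hε).le).mul ((h.nonneg_V hε.le hV).mul h.nonneg_F)

theorem nonneg_sum_pow_sub (h : RenewalSeries P F U) (hε : 0 < ε)
    (hV : V * (C (1 + ε) - P) = 1) (i : ℕ) :
    CoeffNonneg (C (ε⁻¹ ^ i) * PowerSeries.mk 1 - V ^ i * PowerSeries.mk 1) := by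
  induction i with
  | zero => intro n; simp
  | succ i ih =>
    have e : C (ε⁻¹ ^ (i + 1)) * PowerSeries.mk 1 - V ^ (i + 1) * PowerSeries.mk 1
        = C ε⁻¹ * (C (ε⁻¹ ^ i) * PowerSeries.mk 1 - V ^ i * PowerSeries.mk 1) + V ^ i * (C ε⁻¹ * PowerSeries.mk 1 - V * PowerSeries.mk 1) := by
      rw [pow_succ ε⁻¹, map_mul]; ring
    rw [e]
    exact ((CoeffNonneg.const (inv_pos.2 hε).le).mul ih).add
      (((h.nonneg_V hε.le hV).pow i).mul (h.nonneg_sum_sub hε hV))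

theorem derivative_pow (hV : V * (C (1 + ε) - P) = 1) (i : ℕ) :
    derivative ℝ (V ^ (i + 1)) = C ((i + 1 : ℕ) : ℝ) * (V ^ (i + 2) * derivative ℝ P) := by
  have h1 := congrArg (derivative ℝ) hV
  rw [Derivation.leibniz, map_sub, derivative_C, Derivation.map_one_eq_zero] at h1
  simp only [smul_eq_mul] at h1
  have h2 : derivative ℝ V = V ^ 2 * derivative ℝ P := by
    linear_combination V * h1 - derivative ℝ V * hV
  rw [Derivation.leibniz_pow, h2]
  simp only [Nat.add_sub_cancel, nsmul_eq_mul, smul_eq_mul, map_natCast]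
  ring

/-- Multiplying the `n`-th coefficient by `n` amounts to applying `X d/dX`, which turns `V ^ (i +
1)` into `(i + 1) V ^ (i + 2) X P'`. Coefficientwise, Doney's condition gives `X P' ≤ D F`. Then `V
^ (i + 2) F ≤ V ^ (i + 1) U F = V ^ (i + 1) / (1 - X)`, whose coefficients are at most `ε⁻¹ ^ (i +
1)`. -/
theorem coeff_pow_le (h : RenewalSeries P F U) (hε : 0 < ε) (hV : V * (C (1 + ε) - P) = 1)
    {D : ℝ} (hD : 0 ≤ D) (hDoney : ∀ n : ℕ, (n : ℝ) * coeff n P ≤ D * coeff n F) (i n : ℕ) :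
    (n : ℝ) * coeff n (V ^ (i + 1)) ≤ (i + 1) * (D * ε⁻¹ ^ (i + 1)) := by
  have hVn := h.nonneg_V hε.le hV
  have hθ : CoeffNonneg (C D * F - X * derivative ℝ P) := fun n => by
    rw [map_sub, coeff_C_mul, coeff_X_mul_derivative]
    linarith [hDoney n]
  -- Each summand on the right is the defect of one inequality of the chain, hence has nonnegative
  -- coefficients.
  have e : C (D * ε⁻¹ ^ (i + 1)) * PowerSeries.mk 1 - V ^ (i + 2) * (X * derivative ℝ P)
      = V ^ (i + 2) * (C D * F - X * derivative ℝ P) + C D * (V ^ (i + 1) * (U - V) * F)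
        + C D * (C (ε⁻¹ ^ (i + 1)) * PowerSeries.mk 1 - V ^ (i + 1) * PowerSeries.mk 1) := by
    rw [map_mul]
    linear_combination (C D * V ^ (i + 1)) * (-h.mul_F)
  have hn : CoeffNonneg (C (D * ε⁻¹ ^ (i + 1)) * PowerSeries.mk 1 - V ^ (i + 2) * (X * derivative ℝ P)) := by
    rw [e]
    refine (((hVn.pow _).mul hθ).add ((CoeffNonneg.const hD).mul
      (((hVn.pow _).mul (h.nonneg_U_sub_V hε.le hV)).mul h.nonneg_F))).add
      ((CoeffNonneg.const hD).mul (h.nonneg_sum_pow_sub hε hV _))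
  have h1 := hn n
  rw [map_sub, coeff_C_mul, coeff_mk] at h1
  rw [← coeff_X_mul_derivative, derivative_pow hV,
    show X * (C ((i + 1 : ℕ) : ℝ) * (V ^ (i + 2) * derivative ℝ P))
      = C ((i + 1 : ℕ) : ℝ) * (V ^ (i + 2) * (X * derivative ℝ P)) by ring, coeff_C_mul]
  push_cast
  refine mul_le_mul_of_nonneg_left ?_ (by positivity)
  simp at h1 ⊢
  linarith

/-- The resolvent identity iterated `M` times. Doney's condition controls the sum; the remainder is
left to Fourier analysis, where `M` powers of `V` provide decay. -/
theorem U_eq_sum (h : RenewalSeries P F U) (hV : V * (C (1 + ε) - P) = 1) (M : ℕ) :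
    U = ∑ i ∈ Finset.range M, C (ε ^ i) * V ^ (i + 1) + C (ε ^ M) * (U * V ^ M) := by
  induction M with
  | zero => simp
  | succ M ih =>
    rw [Finset.sum_range_succ, pow_succ ε M, map_mul]
    linear_combination ih + (C (ε ^ M) * V ^ M) * h.U_eq hV

/-- Under Doney's condition the contribution of few renewals is small. -/
theorem abs_coeff_sub_le (h : RenewalSeries P F U) (hε : 0 < ε) (hV : V * (C (1 + ε) - P) = 1)
    {D : ℝ} (hD : 0 ≤ D) (hDoney : ∀ n : ℕ, (n : ℝ) * coeff n P ≤ D * coeff n F) (M n : ℕ) :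
    (n : ℝ) * |coeff n U - ε ^ M * coeff n (U * V ^ M)|
      ≤ D * ε⁻¹ * ∑ i ∈ Finset.range M, ((i : ℝ) + 1) := by
  have h1 : coeff n U - ε ^ M * coeff n (U * V ^ M)
      = ∑ i ∈ Finset.range M, ε ^ i * coeff n (V ^ (i + 1)) := by
    have := congrArg (coeff n) (h.U_eq_sum hV M)
    rw [map_add, map_sum, coeff_C_mul] at this
    simp only [coeff_C_mul] at this
    linarith
  rw [h1, abs_of_nonneg (Finset.sum_nonneg fun i _ => mul_nonneg (pow_nonneg hε.le _)
    ((h.nonneg_V hε.le hV).pow _ _)), Finset.mul_sum, Finset.mul_sum]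
  refine Finset.sum_le_sum fun i _ => ?_
  have h2 := h.coeff_pow_le hε hV hD hDoney i n
  calc (n : ℝ) * (ε ^ i * coeff n (V ^ (i + 1))) = ε ^ i * (n * coeff n (V ^ (i + 1))) := by ring
    _ ≤ ε ^ i * ((i + 1) * (D * ε⁻¹ ^ (i + 1))) := by gcongr
    _ = D * ε⁻¹ * (i + 1) := by
      rw [pow_succ]
      have : ε ^ i * ε⁻¹ ^ i = 1 := by rw [← mul_pow, mul_inv_cancel₀ hε.ne', one_pow]
      linear_combination (i + 1) * D * ε⁻¹ * this

end RenewalSeries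
end Renewal

/-! ### Fourier inversion on the unit circle. -/

namespace Renewal
open PowerSeries

/-- Absolute summability of the coefficients. -/
def AbsSummable (A : PowerSeries ℝ) : Prop := Summable fun n => ‖((coeff n A : ℝ) : ℂ)‖

/-- The value of a power series at the point `exp (i t)` of the unit circle. -/
noncomputable def circleEval (A : PowerSeries ℝ) (t : ℝ) : ℂ :=
  ∑' n, ((coeff n A : ℝ) : ℂ) * Complex.exp (t * Complex.I) ^ n

theorem norm_coeff_mul_exp_pow (a : ℂ) (t : ℝ) (n : ℕ) :
    ‖a * Complex.exp (t * Complex.I) ^ n‖ = ‖a‖ := by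
  rw [norm_mul, norm_pow, Complex.norm_exp_ofReal_mul_I, one_pow, mul_one]

namespace AbsSummable
variable {A B : PowerSeries ℝ}

theorem summable (hA : AbsSummable A) (t : ℝ) :
    Summable fun n => ‖((coeff n A : ℝ) : ℂ) * Complex.exp (t * Complex.I) ^ n‖ := by
  simp_rw [norm_coeff_mul_exp_pow]; exact hA

theorem continuous (hA : AbsSummable A) : Continuous (circleEval A) := by
  refine continuous_tsum (fun n => by fun_prop) hA fun n t => ?_
  rw [norm_coeff_mul_exp_pow]

theorem coeff_mul_eq (A B : PowerSeries ℝ) (t : ℝ) (n : ℕ) :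
    ((coeff n (A * B) : ℝ) : ℂ) * Complex.exp (t * Complex.I) ^ n
      = ∑ kl ∈ Finset.HasAntidiagonal.antidiagonal n,
        (((coeff kl.1 A : ℝ) : ℂ) * Complex.exp (t * Complex.I) ^ kl.1)
          * (((coeff kl.2 B : ℝ) : ℂ) * Complex.exp (t * Complex.I) ^ kl.2) := by
  rw [coeff_mul, Complex.ofReal_sum, Finset.sum_mul]
  refine Finset.sum_congr rfl fun x hx => ?_
  rw [← Finset.HasAntidiagonal.mem_antidiagonal.1 hx, pow_add]
  push_cast
  ring

theorem mul (hA : AbsSummable A) (hB : AbsSummable B) : AbsSummable (A * B) := by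
  have := summable_norm_sum_mul_antidiagonal_of_summable_norm (hA.summable 0) (hB.summable 0)
  simp_rw [← coeff_mul_eq, norm_coeff_mul_exp_pow] at this
  exact this

theorem circleEval_mul (hA : AbsSummable A) (hB : AbsSummable B) (t : ℝ) :
    circleEval (A * B) t = circleEval A t * circleEval B t := by
  unfold circleEval
  rw [tsum_mul_tsum_eq_tsum_sum_antidiagonal_of_summable_norm (hA.summable t) (hB.summable t)]
  exact tsum_congr fun n => coeff_mul_eq A B t n

theorem const (c : ℝ) : AbsSummable (C c) := by
  refine summable_of_ne_finset_zero (s := {0}) fun n hn => ?_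
  rw [coeff_C, if_neg (by simpa using hn)]; simp

theorem circleEval_const (c t : ℝ) : circleEval (C c) t = c := by
  unfold circleEval
  rw [tsum_eq_single 0 fun n hn => by rw [coeff_C, if_neg hn]; simp]
  simp

theorem one : AbsSummable 1 := by
  have := const 1; rwa [map_one] at this

theorem circleEval_one (t : ℝ) : circleEval 1 t = 1 := by
  have := circleEval_const 1 t; rwa [map_one, Complex.ofReal_one] at this

theorem pow (hA : AbsSummable A) : ∀ k : ℕ, AbsSummable (A ^ k)
  | 0 => by rw [pow_zero]; exact one
  | k + 1 => by rw [pow_succ]; exact (hA.pow k).mul hA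

theorem circleEval_pow (hA : AbsSummable A) (t : ℝ) :
    ∀ k : ℕ, circleEval (A ^ k) t = circleEval A t ^ k
  | 0 => by rw [pow_zero, pow_zero, circleEval_one]
  | k + 1 => by rw [pow_succ, (hA.pow k).circleEval_mul hA, pow_succ, hA.circleEval_pow t k]

theorem sub (hA : AbsSummable A) (hB : AbsSummable B) : AbsSummable (A - B) := by
  refine Summable.of_nonneg_of_le (fun _ => norm_nonneg _) (fun n => ?_) (Summable.add hA hB)
  rw [map_sub, Complex.ofReal_sub]
  exact norm_sub_le _ _

theorem circleEval_sub (hA : AbsSummable A) (hB : AbsSummable B) (t : ℝ) :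
    circleEval (A - B) t = circleEval A t - circleEval B t := by
  unfold circleEval
  rw [← (hA.summable t).of_norm.tsum_sub (hB.summable t).of_norm]
  refine tsum_congr fun n => ?_
  rw [map_sub, Complex.ofReal_sub, sub_mul]

theorem of_sum_le (hA : CoeffNonneg A) {c : ℝ}
    (h : ∀ n, ∑ k ∈ Finset.range n, coeff k A ≤ c) : AbsSummable A := by
  refine (summable_of_sum_range_le hA h).congr fun n => ?_
  rw [Complex.norm_real, Real.norm_of_nonneg (hA n)]

theorem integral_exp (k n : ℕ) :
    ∫ t in (-Real.pi)..Real.pi, Complex.exp (t * Complex.I) ^ k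
      * Complex.exp (-(n * t) * Complex.I) = if k = n then 2 * (Real.pi : ℂ) else 0 := by
  have e : ∀ t : ℝ, Complex.exp (t * Complex.I) ^ k * Complex.exp (-(n * t) * Complex.I)
      = Complex.exp ((((k : ℂ) - n) * Complex.I) * t) := fun t => by
    rw [← Complex.exp_nat_mul, ← Complex.exp_add]; congr 1; ring
  simp_rw [e]
  split_ifs with h
  · subst h
    simp
    ring
  · have hc : ((k : ℂ) - n) * Complex.I ≠ 0 :=
      mul_ne_zero (sub_ne_zero.2 (by exact_mod_cast h)) Complex.I_ne_zero
    rw [integral_exp_mul_complex hc, div_eq_zero_iff]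
    left
    rw [sub_eq_zero, Complex.exp_eq_exp_iff_exists_int]
    refine ⟨(k : ℤ) - n, ?_⟩
    push_cast
    ring

theorem integral_circleEval (hA : AbsSummable A) (n : ℕ) :
    ∫ t in (-Real.pi)..Real.pi, circleEval A t * Complex.exp (-(n * t) * Complex.I)
      = 2 * Real.pi * ((coeff n A : ℝ) : ℂ) := by
  have hn : ∀ t : ℝ, ‖Complex.exp (-(n * t) * Complex.I)‖ = 1 := fun t => by
    have := Complex.norm_exp_ofReal_mul_I (-(n * t))
    push_cast at this
    exact this
  have key := intervalIntegral.hasSum_integral_of_dominated_convergence (μ := volume)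
    (a := -Real.pi) (b := Real.pi)
    (F := fun k (t : ℝ) => ((coeff k A : ℝ) : ℂ) * Complex.exp (t * Complex.I) ^ k
      * Complex.exp (-(n * t) * Complex.I))
    (f := fun t => circleEval A t * Complex.exp (-(n * t) * Complex.I))
    (fun k _ => ‖((coeff k A : ℝ) : ℂ)‖)
    (fun k => by
      refine Continuous.aestronglyMeasurable ?_
      fun_prop)
    (fun k => ae_of_all _ fun t _ => by rw [norm_mul, hn, norm_coeff_mul_exp_pow, mul_one])
    (ae_of_all _ fun t _ => hA) intervalIntegrable_const
    (ae_of_all _ fun t _ => ((hA.summable t).of_norm.hasSum).mul_right _)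
  rw [← key.tsum_eq]
  simp_rw [mul_assoc, intervalIntegral.integral_const_mul, integral_exp]
  rw [tsum_eq_single n fun k hk => by rw [if_neg hk, mul_zero], if_pos rfl]
  ring

end AbsSummable

namespace RenewalSeries
variable {P F U V : PowerSeries ℝ} {ε : ℝ}

theorem absSummable_V (h : RenewalSeries P F U) (hε : 0 < ε) (hV : V * (C (1 + ε) - P) = 1) :
    AbsSummable V := by
  refine AbsSummable.of_sum_le (h.nonneg_V hε.le hV) (c := ε⁻¹) fun n => ?_
  have h1 := h.nonneg_sum_sub hε hV n
  rw [map_sub, coeff_C_mul, coeff_mul,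
    Finset.Nat.sum_antidiagonal_eq_sum_range_succ_mk, Finset.sum_range_succ] at h1
  have := h.nonneg_V hε.le hV n
  simp at h1
  linarith

theorem circleEval_V (h : RenewalSeries P F U) (hP : AbsSummable P) (hε : 0 < ε)
    (hV : V * (C (1 + ε) - P) = 1) (t : ℝ) :
    circleEval V t = (ε + (1 - circleEval P t))⁻¹ := by
  have h1 := congrArg (circleEval · t) hV
  have hc := AbsSummable.const (1 + ε)
  simp only [(h.absSummable_V hε hV).circleEval_mul (hc.sub hP), hc.circleEval_sub hP,
    AbsSummable.circleEval_const, AbsSummable.circleEval_one] at h1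
  rw [eq_inv_of_mul_eq_one_left h1]
  push_cast
  ring

end RenewalSeries

theorem norm_le_norm_add_of_re_nonneg {w : ℂ} (hw : 0 ≤ w.re) {κ : ℝ} (hκ : 0 ≤ κ) :
    ‖w‖ ≤ ‖(κ : ℂ) + w‖ := by
  rw [Complex.norm_def, Complex.norm_def]
  refine Real.sqrt_le_sqrt ?_
  rw [Complex.normSq_apply, Complex.normSq_apply]
  simp
  nlinarith

theorem le_norm_add_of_re_nonneg {w : ℂ} (hw : 0 ≤ w.re) (κ : ℝ) :
    κ ≤ ‖(κ : ℂ) + w‖ := by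
  refine le_trans ?_ (Complex.re_le_norm _)
  simpa using hw

/-- The coefficients of `U` need not be summable, so `U` is approximated by series `W j` with
discount `κ j → 0`, for which termwise Fourier inversion is legitimate; both sides then pass to the
limit. -/
theorem RenewalSeries.coeff_mul_pow_eq_integral {P F U V : PowerSeries ℝ} {ε : ℝ}
    (h : RenewalSeries P F U) (hP : AbsSummable P)
    (hint : IntervalIntegrable (fun t => ‖1 - circleEval P t‖⁻¹) volume (-Real.pi) Real.pi)
    (hne : ∀ t ∈ Set.uIoc (-Real.pi) Real.pi, t ≠ 0 → circleEval P t ≠ 1)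
    (hre : ∀ t, 0 ≤ (1 - circleEval P t).re) (hε : 0 < ε)
    (hV : V * (C (1 + ε) - P) = 1) (M n : ℕ) :
    2 * Real.pi * ((coeff n (U * V ^ M) : ℝ) : ℂ) = ∫ t in (-Real.pi)..Real.pi,
      (1 - circleEval P t)⁻¹ * ((ε + (1 - circleEval P t))⁻¹) ^ M
        * Complex.exp (-(n * t) * Complex.I) := by
  set κ : ℕ → ℝ := fun j => 1 / ((j : ℝ) + 1) with hκ
  have hκ0 : ∀ j, 0 < κ j := fun j => by positivity
  have hκt : Tendsto κ atTop (𝓝 0) := tendsto_one_div_add_atTop_nhds_zero_nat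
  choose W hW using fun j => exists_mul_C_sub (P := P) h.coeff_zero_P
    (show 0 < 1 + κ j by linarith [hκ0 j])
  have hcont := hP.continuous
  have hVn := h.nonneg_V hε.le hV
  have hUn := h.nonneg_U
  -- Coefficientwise, `0 ≤ U - W j = κ j U (W j) ≤ κ j U²`.
  have hcoef : Tendsto (fun j => coeff n (W j * V ^ M)) atTop (𝓝 (coeff n (U * V ^ M))) := by
    have hb : ∀ j, coeff n (U * V ^ M) - coeff n (W j * V ^ M) ∈
        Set.Icc 0 (κ j * coeff n (U * U * V ^ M)) := by
      intro j
      have e := h.U_eq (hW j)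
      have e1 : U * V ^ M - W j * V ^ M = C (κ j) * (U * W j * V ^ M) := by
        linear_combination V ^ M * e
      have hWn := h.nonneg_V (hκ0 j).le (hW j)
      have h1 := congrArg (coeff n) e1
      rw [map_sub, coeff_C_mul] at h1
      rw [h1]
      refine ⟨mul_nonneg (hκ0 j).le (((hUn.mul hWn).mul (hVn.pow M)) n),
        mul_le_mul_of_nonneg_left ?_ (hκ0 j).le⟩
      have h2 := ((hUn.mul (h.nonneg_U_sub_V (hκ0 j).le (hW j))).mul (hVn.pow M)) n
      rw [show U * (U - W j) * V ^ M = U * U * V ^ M - U * W j * V ^ M by ring, map_sub] at h2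
      linarith
    have h0 : Tendsto (fun j => coeff n (U * V ^ M) - coeff n (W j * V ^ M)) atTop (𝓝 0) := by
      refine squeeze_zero (fun j => (hb j).1) (fun j => (hb j).2) ?_
      simpa using hκt.mul_const (coeff n (U * U * V ^ M))
    simpa using h0.const_sub (coeff n (U * V ^ M))
  have hL : Tendsto (fun j => 2 * (Real.pi : ℂ) * ((coeff n (W j * V ^ M) : ℝ) : ℂ)) atTop
      (𝓝 (2 * Real.pi * ((coeff n (U * V ^ M) : ℝ) : ℂ))) :=
    ((Complex.continuous_ofReal.tendsto _).comp hcoef).const_mul _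
  refine tendsto_nhds_unique hL ?_
  have hE : ∀ t : ℝ, ‖Complex.exp (-(n * t) * Complex.I)‖ = 1 := fun t => by
    have := Complex.norm_exp_ofReal_mul_I (-(n * t))
    push_cast at this
    exact this
  have hI : ∀ j, 2 * (Real.pi : ℂ) * ((coeff n (W j * V ^ M) : ℝ) : ℂ)
      = ∫ t in (-Real.pi)..Real.pi, (κ j + (1 - circleEval P t))⁻¹
        * ((ε + (1 - circleEval P t))⁻¹) ^ M * Complex.exp (-(n * t) * Complex.I) := by
    intro j
    have hWs := h.absSummable_V (hκ0 j) (hW j)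
    have hVs := h.absSummable_V hε hV
    rw [← (hWs.mul (hVs.pow M)).integral_circleEval n]
    refine intervalIntegral.integral_congr fun t _ => ?_
    rw [hWs.circleEval_mul (hVs.pow M), hVs.circleEval_pow, h.circleEval_V hP (hκ0 j) (hW j),
      h.circleEval_V hP hε hV]
  simp_rw [hI]
  -- Since `1 - circleEval P t` has nonnegative real part, adding `κ j` only increases its modulus,
  -- so one majorant serves all `j`.
  refine intervalIntegral.tendsto_integral_filter_of_dominated_convergence
    (fun t => ‖1 - circleEval P t‖⁻¹ * ε⁻¹ ^ M) ?_ ?_ (hint.mul_const _) ?_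
  · refine Eventually.of_forall fun j => Measurable.aestronglyMeasurable ?_
    have := hcont.measurable
    fun_prop
  · refine Eventually.of_forall fun j => ?_
    filter_upwards [Measure.ae_ne volume (0 : ℝ)] with t ht0 ht
    have h1 : 0 < ‖1 - circleEval P t‖ := norm_pos_iff.2 (sub_ne_zero.2 (hne t ht ht0).symm)
    rw [norm_mul, norm_mul, hE, mul_one, norm_inv, norm_pow, norm_inv]
    refine mul_le_mul ?_ ?_ (by positivity) (by positivity)
    · exact inv_anti₀ h1 (norm_le_norm_add_of_re_nonneg (hre t) (hκ0 j).le)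
    · refine pow_le_pow_left₀ (by positivity) ?_ _
      exact inv_anti₀ hε (le_norm_add_of_re_nonneg (hre t) ε)
  · filter_upwards [Measure.ae_ne volume (0 : ℝ)] with t ht0 ht
    have h1 : 1 - circleEval P t ≠ 0 := sub_ne_zero.2 (hne t ht ht0).symm
    refine Tendsto.mul_const _ (Tendsto.mul_const _ ?_)
    have h2 : Tendsto (fun j => (κ j : ℂ) + (1 - circleEval P t)) atTop
        (𝓝 (((0 : ℝ) : ℂ) + (1 - circleEval P t))) :=
      ((Complex.continuous_ofReal.tendsto _).comp hκt).add_const _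
    rw [Complex.ofReal_zero, zero_add] at h2
    exact h2.inv₀ h1

end Renewal

/-! ### Regularly varying laws and lower bounds for the characteristic function. -/

namespace Renewal
open PowerSeries

/-- Completeness gives a limit without naming it, so no limiting constant has to be computed from a
Fourier integral. -/
theorem exists_tendsto_of_approx {E : Type*} [NormedAddCommGroup E] [CompleteSpace E] {x : ℕ → E}
    (h : ∀ ε > 0, ∃ (y : ℕ → E) (l : E), Tendsto y atTop (𝓝 l) ∧
      ∀ᶠ n in atTop, ‖x n - y n‖ ≤ ε) : ∃ l, Tendsto x atTop (𝓝 l) := by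
  refine cauchySeq_tendsto_of_complete (Metric.cauchySeq_iff'.2 fun ε hε => ?_)
  obtain ⟨y, l, hy, hxy⟩ := h (ε / 5) (by linarith)
  have h1 := hy.eventually (Metric.ball_mem_nhds l (show 0 < ε / 5 by linarith))
  obtain ⟨N, hN⟩ := eventually_atTop.1 (h1.and hxy)
  refine ⟨N, fun n hn => ?_⟩
  obtain ⟨a1, a2⟩ := hN n hn
  obtain ⟨b1, b2⟩ := hN N le_rfl
  rw [← dist_eq_norm] at a2 b2
  have t1 := dist_triangle (x n) (y n) (x N)
  have t2 := dist_triangle (y n) l (x N)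
  have t3 := dist_triangle l (y N) (x N)
  rw [dist_comm l (y N), dist_comm (y N) (x N)] at t3
  linarith

/-- One bound for both orders of `m` and `n`: the lower Potter bound produces `x ^ γ`, the upper one
`x ^ γ'`. -/
theorem RegVar.exists_le_mul {β : ℝ} {f : ℕ → ℝ} (hf : RegVar β f) {γ γ' : ℝ} (hγ0 : 0 ≤ γ)
    (hγ : γ < β) (hγ' : β < γ') :
    ∃ K > 0, ∀ m n : ℕ, 1 ≤ m → 1 ≤ n → ∀ x : ℝ, 0 < x → (m : ℝ) ≤ n * x →
      f n ≤ K * f m * (x ^ γ + x ^ γ') := by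
  obtain ⟨C₁, h₁⟩ := hf.lower γ hγ
  obtain ⟨C₂, h₂⟩ := hf.upper γ' hγ'
  set K := max 1 (max C₁ C₂) with hK
  have hK1 : C₁ ≤ K := (le_max_left _ _).trans (le_max_right _ _)
  have hK2 : C₂ ≤ K := (le_max_right _ _).trans (le_max_right _ _)
  have hK0 : 0 < K := one_pos.trans_le (le_max_left _ _)
  refine ⟨K, hK0, fun m n hm hn x hx hmn => ?_⟩
  have hm0 : (0 : ℝ) < m := by exact_mod_cast hm
  have hn0 : (0 : ℝ) < n := by exact_mod_cast hn
  have hfm := hf.pos m hm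
  rcases le_total m n with h | h
  · calc f n ≤ C₁ * f m * ((n : ℝ) / m) ^ (-γ) := h₁ m n hm h
      _ ≤ K * f m * (x ^ γ + 0) := by
        rw [Real.rpow_neg (by positivity), ← Real.inv_rpow (by positivity), inv_div, add_zero]
        gcongr
        rw [div_le_iff₀ hn0]; linarith
      _ ≤ _ := by gcongr; positivity
  · calc f n ≤ C₂ * f m * ((m : ℝ) / n) ^ γ' := h₂ n m hn h
      _ ≤ K * f m * (0 + x ^ γ') := by
        rw [zero_add]
        have : 0 ≤ γ' := by linarith
        gcongr
        rw [div_le_iff₀ hn0]; linarith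
      _ ≤ _ := by gcongr; positivity

/-- An aperiodic probability mass function `p` on the positive integers whose tail `f` is
regularly varying of index `-β` with `0 < β < 1`. -/
structure RegVarLaw (β : ℝ) (p f : ℕ → ℝ) : Prop where
  pos_index : 0 < β
  index_lt_one : β < 1
  zero : p 0 = 0
  succ : ∀ n, p (n + 1) = f n - f (n + 1)
  tail_zero : f 0 = 1
  tail_pos : ∀ n, 0 < f n
  antitone : Antitone f
  regVar : RegVar β f
  aperiodic : ∀ d : ℕ, (∀ n, 0 < p n → d ∣ n) → d = 1

namespace RegVarLaw
variable {β : ℝ} {p f : ℕ → ℝ}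

theorem nonneg (h : RegVarLaw β p f) (n : ℕ) : 0 ≤ p n := by
  cases n with
  | zero => rw [h.zero]
  | succ n => rw [h.succ]; exact sub_nonneg.2 (h.antitone n.le_succ)

theorem tail_le_one (h : RegVarLaw β p f) (n : ℕ) : f n ≤ 1 := by
  rw [← h.tail_zero]; exact h.antitone n.zero_le

theorem sum_range (h : RegVarLaw β p f) (n : ℕ) :
    ∑ k ∈ Finset.range (n + 1), p k = 1 - f n := by
  induction n with
  | zero => simp [h.zero, h.tail_zero]
  | succ n ih => rw [Finset.sum_range_succ, ih, h.succ]; ring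

theorem hasSum (h : RegVarLaw β p f) : HasSum p 1 := by
  rw [hasSum_iff_tendsto_nat_of_nonneg h.nonneg, ← tendsto_add_atTop_iff_nat 1]
  simp_rw [h.sum_range]
  simpa using (h.regVar.tendsto_zero h.pos_index).const_sub 1

theorem absSummable (h : RegVarLaw β p f) : AbsSummable (PowerSeries.mk p) := by
  refine AbsSummable.of_sum_le (fun n => ?_) (c := 1) fun n => ?_
  · rw [coeff_mk]; exact h.nonneg n
  · simp_rw [coeff_mk]
    exact sum_le_hasSum _ (fun k _ => h.nonneg k) h.hasSum

theorem hasSum_one_sub (h : RegVarLaw β p f) (t : ℝ) :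
    HasSum (fun n => (p n : ℂ) * (1 - Complex.exp (t * Complex.I) ^ n))
      (1 - circleEval (PowerSeries.mk p) t) := by
  have h1 : HasSum (fun n => (p n : ℂ)) 1 := by
    have := Complex.hasSum_ofReal.2 h.hasSum
    simpa using this
  have h2 := (h.absSummable.summable t).of_norm.hasSum
  refine (h1.sub h2).congr_fun fun n => ?_
  rw [coeff_mk]; ring

theorem exp_pow_re (t : ℝ) (n : ℕ) : (Complex.exp (t * Complex.I) ^ n).re = Real.cos (n * t) := by
  rw [← Complex.exp_nat_mul, ← mul_assoc]
  have := Complex.exp_ofReal_mul_I_re (n * t)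
  push_cast at this
  exact this

theorem hasSum_re (h : RegVarLaw β p f) (t : ℝ) :
    HasSum (fun n => p n * (1 - Real.cos (n * t)))
      (1 - circleEval (PowerSeries.mk p) t).re := by
  refine (Complex.hasSum_re (h.hasSum_one_sub t)).congr_fun fun n => ?_
  rw [Complex.re_ofReal_mul, Complex.sub_re, exp_pow_re, Complex.one_re]

theorem term_nonneg (h : RegVarLaw β p f) (t : ℝ) (n : ℕ) : 0 ≤ p n * (1 - Real.cos (n * t)) :=
  mul_nonneg (h.nonneg n) (sub_nonneg.2 (Real.cos_le_one _))

theorem re_nonneg (h : RegVarLaw β p f) (t : ℝ) :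
    0 ≤ (1 - circleEval (PowerSeries.mk p) t).re :=
  (h.hasSum_re t).nonneg (h.term_nonneg t)

/-- Equality would force `cos (n t) = 1` whenever `p n > 0`, so the order of `exp (i t)` would
divide every such `n`. Aperiodicity makes that order `1`, whence `t` is a multiple of `2π`. -/
theorem circleEval_ne_one (h : RegVarLaw β p f) {t : ℝ} (ht : |t| ≤ Real.pi) (ht0 : t ≠ 0) :
    circleEval (PowerSeries.mk p) t ≠ 1 := by
  intro h1
  have h2 := h.hasSum_re t
  rw [h1, sub_self, Complex.zero_re, hasSum_zero_iff_of_nonneg (h.term_nonneg t)] at h2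
  have h3 := h.aperiodic (orderOf (Complex.exp (t * Complex.I))) fun n hn => by
    have h4 := congrFun h2 n
    rw [Pi.zero_apply, mul_eq_zero, or_iff_right hn.ne', sub_eq_zero] at h4
    refine orderOf_dvd_of_pow_eq_one ?_
    have h5 : ‖Complex.exp (t * Complex.I) ^ n‖ = 1 := by
      rw [norm_pow, Complex.norm_exp_ofReal_mul_I, one_pow]
    have h6 := exp_pow_re t n
    rw [← h4] at h6
    set z := Complex.exp (t * Complex.I) ^ n
    have h7 : z.im = 0 := by
      rw [← sq_eq_zero_iff]
      have := Complex.sq_norm z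
      rw [Complex.normSq_apply, h5, h6] at this
      linarith
    exact Complex.ext h6 (by simpa using h7)
  rw [orderOf_eq_one_iff, Complex.exp_eq_one_iff] at h3
  obtain ⟨n, hn⟩ := h3
  have hn' : t = n * (2 * Real.pi) := by
    have e : (n : ℂ) * (2 * Real.pi * Complex.I) = (n * (2 * Real.pi) : ℂ) * Complex.I := by ring
    rw [e] at hn
    have := mul_right_cancel₀ Complex.I_ne_zero hn
    exact_mod_cast this
  rw [hn', abs_mul, abs_of_pos (show 0 < 2 * Real.pi by positivity)] at ht
  have hpi := Real.pi_pos
  have h8 : |(n : ℝ)| < 1 := by nlinarith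
  rw [← Int.cast_abs] at h8
  have h9 : |n| < 1 := by exact_mod_cast h8
  rw [Int.abs_lt_one_iff] at h9
  exact ht0 (by rw [hn', h9]; simp)

theorem cos_le_cos_one {x : ℝ} (h1 : 1 ≤ x) (h4 : x ≤ 4) : Real.cos x ≤ Real.cos 1 := by
  rcases le_total x Real.pi with h | h
  · exact Real.cos_le_cos_of_nonneg_of_le_pi zero_le_one h h1
  · have hpi := Real.pi_gt_three
    exact (Real.cos_nonpos_of_pi_div_two_le_of_le (by linarith) (by linarith)).trans
      Real.cos_one_pos.le

theorem sum_Ioc (h : RegVarLaw β p f) {k n : ℕ} (hkn : k ≤ n) :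
    ∑ j ∈ Finset.Ioc k n, p j = f k - f n := by
  induction n, hkn using Nat.le_induction with
  | base => simp
  | succ n hn ih =>
    rw [← Finset.insert_Ioc_right_eq_Ioc_add_one hn, Finset.sum_insert (by simp), ih, h.succ]
    ring

/-- Near `0`, the real part `∑ p j (1 - cos (j t))` is at least a constant times `f k - f (2 k)`
with `k ≈ 1 / |t|`, and this is comparable to `f k` because `f (2 k) / f k` tends to `2 ^ (-β) < 1`.
Away from `0`, compactness and aperiodicity suffice. -/
theorem exists_lower_bound (h : RegVarLaw β p f) :
    ∃ c > 0, ∀ t : ℝ, t ≠ 0 → |t| ≤ Real.pi →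
      c * f ⌈1 / |t|⌉₊ ≤ ‖1 - circleEval (PowerSeries.mk p) t‖ := by
  have hr : Tendsto (fun n => f (2 * n) / f n) atTop (𝓝 ((2 : ℝ) ^ (-β))) := by
    refine h.regVar.ratio 2 (by norm_num) _ (tendsto_const_nhds.congr' ?_)
    filter_upwards [eventually_ge_atTop 1] with n hn
    have hn0 : (0 : ℝ) < n := by exact_mod_cast hn
    push_cast
    field_simp
  have hlt : (2 : ℝ) ^ (-β) < 1 := Real.rpow_lt_one_of_one_lt_of_neg (by norm_num)
    (by linarith [h.pos_index])
  obtain ⟨r, hr1, hr2⟩ := exists_between hlt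
  obtain ⟨K, hK⟩ := eventually_atTop.1 (hr.eventually (gt_mem_nhds hr1))
  -- For `|t|` below this threshold, `⌈1 / |t|⌉` is at least `K`.
  set t0 : ℝ := 1 / ((K : ℝ) + 1) with ht0
  have ht0pos : 0 < t0 := by positivity
  have ht01 : t0 ≤ 1 := by rw [ht0, div_le_one (by positivity)]; simp
  have hq : 0 < 1 - Real.cos 1 := by
    have := Real.cos_one_le
    linarith
  have hcomp : ∃ c > 0, ∀ t : ℝ, t0 ≤ |t| → |t| ≤ Real.pi →
      c ≤ ‖1 - circleEval (PowerSeries.mk p) t‖ := by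
    have hcpt : IsCompact {t : ℝ | t0 ≤ |t| ∧ |t| ≤ Real.pi} := by
      refine (isCompact_Icc (a := -Real.pi) (b := Real.pi)).of_isClosed_subset ?_ ?_
      · exact (isClosed_le continuous_const continuous_abs).inter
          (isClosed_le continuous_abs continuous_const)
      · exact fun t ht => abs_le.1 ht.2
    have hne : {t : ℝ | t0 ≤ |t| ∧ |t| ≤ Real.pi}.Nonempty := by
      refine ⟨1, ?_, ?_⟩
      · simpa using ht01
      · simp only [abs_one]; linarith [Real.pi_gt_three]
    have hc := h.absSummable.continuous
    obtain ⟨t1, ht1, hmin⟩ := hcpt.exists_isMinOn hne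
      (f := fun t => ‖1 - circleEval (PowerSeries.mk p) t‖) (by fun_prop)
    refine ⟨_, norm_pos_iff.2 (sub_ne_zero.2 (h.circleEval_ne_one ht1.2 ?_).symm),
      fun t h1 h2 => hmin ⟨h1, h2⟩⟩
    intro h0
    have := ht1.1
    rw [h0, abs_zero] at this
    linarith
  obtain ⟨c0, hc0, hc⟩ := hcomp
  refine ⟨min c0 ((1 - Real.cos 1) * (1 - r)), lt_min hc0 (mul_pos hq (by linarith)),
    fun t ht htpi => ?_⟩
  set k := ⌈1 / |t|⌉₊ with hk
  have hfk := h.tail_pos k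
  have htpos : 0 < |t| := abs_pos.2 ht
  rcases le_or_gt t0 |t| with h1 | h1
  · calc _ ≤ c0 * 1 := by
          gcongr
          · exact min_le_left _ _
          · exact h.tail_le_one k
      _ ≤ _ := by rw [mul_one]; exact hc t h1 htpi
  · have hk1 : 1 / |t| ≤ k := Nat.le_ceil _
    have hk2 : (k : ℝ) < 1 / |t| + 1 := Nat.ceil_lt_add_one (by positivity)
    have hkt : 1 ≤ (k : ℝ) * |t| := by rwa [div_le_iff₀ htpos] at hk1
    have hkt2 : (k : ℝ) * |t| ≤ 2 := by
      have : (k : ℝ) * |t| ≤ (1 / |t| + 1) * |t| := by gcongr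
      have e : (1 / |t| + 1) * |t| = 1 + |t| := by field_simp
      linarith
    have hKk : K ≤ k := by
      have : (K : ℝ) ≤ k := by
        have h2 : ((K : ℝ) + 1) * |t| < 1 := by
          rw [ht0, lt_div_iff₀ (by positivity)] at h1
          linarith
        by_contra hlt'
        have : (k : ℝ) * |t| ≤ (K : ℝ) * |t| :=
          mul_le_mul_of_nonneg_right (not_le.1 hlt').le htpos.le
        nlinarith
      exact_mod_cast this
    have h3 := hK k hKk
    rw [div_lt_iff₀ hfk] at h3
    calc _ ≤ ((1 - Real.cos 1) * (1 - r)) * f k := by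
          gcongr; exact min_le_right _ _
      _ = (1 - Real.cos 1) * (f k - r * f k) := by ring
      _ ≤ (1 - Real.cos 1) * (f k - f (2 * k)) := by gcongr
      _ = ∑ j ∈ Finset.Ioc k (2 * k), p j * (1 - Real.cos 1) := by
          rw [← h.sum_Ioc (by omega), ← Finset.sum_mul, mul_comm]
      -- Since `1 ≤ k |t| ≤ 2`, the block `k < j ≤ 2 k` places `j |t|` in `[1, 4]`, where the cosine
      -- is at most `cos 1`.
      _ ≤ ∑ j ∈ Finset.Ioc k (2 * k), p j * (1 - Real.cos (j * t)) := by
          refine Finset.sum_le_sum fun j hj => mul_le_mul_of_nonneg_left ?_ (h.nonneg j)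
          have hj := Finset.mem_Ioc.1 hj
          have hj1 : (k : ℝ) ≤ j := by exact_mod_cast hj.1.le
          have hj2 : (j : ℝ) ≤ 2 * k := by exact_mod_cast hj.2
          rw [← Real.cos_abs (j * t), abs_mul, Nat.abs_cast]
          have : Real.cos (j * |t|) ≤ Real.cos 1 := cos_le_cos_one (by nlinarith) (by nlinarith)
          linarith
      _ ≤ (1 - circleEval (PowerSeries.mk p) t).re :=
          sum_le_hasSum _ (fun j _ => h.term_nonneg t j) (h.hasSum_re t)
      _ ≤ _ := Complex.re_le_norm _

/-- The bound on the renewal kernel that dominates the rescaled Fourier integrals. -/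
theorem exists_inv_bound (h : RegVarLaw β p f) {γ γ' : ℝ} (hγ0 : 0 ≤ γ)
    (hγ : γ < β) (hγ' : β < γ') :
    ∃ K > 0, ∀ n : ℕ, 1 ≤ n → ∀ s : ℝ, s ≠ 0 → |s| ≤ n * Real.pi →
      f n * ‖1 - circleEval (PowerSeries.mk p) (s / n)‖⁻¹ ≤ K * (|s| ^ (-γ) + |s| ^ (-γ')) := by
  obtain ⟨c, hc, hlow⟩ := h.exists_lower_bound
  obtain ⟨K, hK, hpot⟩ := h.regVar.exists_le_mul hγ0 hγ hγ'
  set A := (1 + Real.pi) ^ γ + (1 + Real.pi) ^ γ' with hA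
  have hpi := Real.pi_pos
  refine ⟨c⁻¹ * K * A, by positivity, fun n hn s hs hsn => ?_⟩
  have hn0 : (0 : ℝ) < n := by exact_mod_cast hn
  have hs0 : 0 < |s| := abs_pos.2 hs
  have e : |s / n| = |s| / n := by rw [abs_div, Nat.abs_cast]
  have h1 := hlow (s / n) (div_ne_zero hs hn0.ne') (by rw [e, div_le_iff₀ hn0]; linarith)
  rw [e, one_div_div] at h1
  set k := ⌈(n : ℝ) / |s|⌉₊ with hk
  have hk1 : 1 ≤ k := Nat.one_le_ceil_iff.2 (by positivity)
  have hk2 : (k : ℝ) < n / |s| + 1 := Nat.ceil_lt_add_one (by positivity)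
  -- As `|s| ≤ n π`, the rounding error `1` of the ceiling is at most `n π / |s|`.
  have hkn : (k : ℝ) ≤ n * ((1 + Real.pi) / |s|) := by
    have : 1 ≤ n * Real.pi / |s| := by rwa [one_le_div hs0]
    have e2 : (n : ℝ) * ((1 + Real.pi) / |s|) = n / |s| + n * Real.pi / |s| := by ring
    linarith
  have h2 := hpot k n hk1 hn _ (by positivity) hkn
  have hfk := h.tail_pos k
  have h3 : ∀ a : ℝ, ((1 + Real.pi) / |s|) ^ a = (1 + Real.pi) ^ a * |s| ^ (-a) := fun a => by
    rw [Real.div_rpow (by positivity) hs0.le, Real.rpow_neg hs0.le, div_eq_mul_inv]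
  rw [h3, h3] at h2
  have hnorm : 0 < ‖1 - circleEval (PowerSeries.mk p) (s / n)‖ :=
    (mul_pos hc hfk).trans_le h1
  rw [← div_eq_mul_inv, div_le_iff₀ hnorm]
  have hB : (1 + Real.pi) ^ γ * |s| ^ (-γ) + (1 + Real.pi) ^ γ' * |s| ^ (-γ')
      ≤ A * (|s| ^ (-γ) + |s| ^ (-γ')) := by
    have q1 : 0 ≤ (1 + Real.pi) ^ γ * |s| ^ (-γ') := by positivity
    have q2 : 0 ≤ (1 + Real.pi) ^ γ' * |s| ^ (-γ) := by positivity
    rw [hA]; linarith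
  calc f n ≤ K * f k * (A * (|s| ^ (-γ) + |s| ^ (-γ'))) := h2.trans (by gcongr)
    _ = c⁻¹ * K * A * (|s| ^ (-γ) + |s| ^ (-γ')) * (c * f k) := by field_simp
    _ ≤ _ := by gcongr

end RegVarLaw
end Renewal

/-! ### Convergence of the rescaled characteristic exponents. -/

namespace Renewal
open PowerSeries
namespace RegVarLaw
variable {β : ℝ} {p f : ℕ → ℝ}

/-- Summation by parts, kept finite because the tail `f` is not summable for an index below `1`. -/
theorem sum_mul_one_sub_pow (h : RegVarLaw β p f) (z : ℂ) (N : ℕ) :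
    ∑ k ∈ Finset.range (N + 1), (p k : ℂ) * (1 - z ^ k) + f N * (1 - z ^ N)
      = (1 - z) * ∑ k ∈ Finset.range N, (f k : ℂ) * z ^ k := by
  induction N with
  | zero => simp
  | succ N ih =>
    rw [Finset.sum_range_succ _ (N + 1), Finset.sum_range_succ (fun k => (f k : ℂ) * z ^ k), h.succ]
    push_cast
    linear_combination ih

theorem norm_one_sub_exp_pow_le (t : ℝ) (n : ℕ) :
    ‖1 - Complex.exp (t * Complex.I) ^ n‖ ≤ 2 := by
  refine (norm_sub_le _ _).trans ?_
  rw [norm_one, norm_pow, Complex.norm_exp_ofReal_mul_I, one_pow]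
  norm_num

/-- Truncated summation by parts for the characteristic function. -/
theorem norm_one_sub_circleEval_sub_le (h : RegVarLaw β p f) (t : ℝ) (N : ℕ) :
    ‖(1 - circleEval (PowerSeries.mk p) t) - (1 - Complex.exp (t * Complex.I))
      * ∑ k ∈ Finset.range N, (f k : ℂ) * Complex.exp (t * Complex.I) ^ k‖ ≤ 4 * f N := by
  set z := Complex.exp (t * Complex.I) with hz
  have h1 := h.hasSum_one_sub t
  have h2 : HasSum (fun k => (p (k + (N + 1)) : ℂ) * (1 - z ^ (k + (N + 1))))
      ((1 - circleEval (PowerSeries.mk p) t)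
        - ∑ k ∈ Finset.range (N + 1), (p k : ℂ) * (1 - z ^ k)) :=
    (hasSum_nat_add_iff' (N + 1)).2 h1
  have h3 : HasSum (fun k => p (k + (N + 1))) (f N) := by
    have := (hasSum_nat_add_iff' (N + 1)).2 h.hasSum
    rwa [h.sum_range, sub_sub_cancel] at this
  have h4 : ‖(1 - circleEval (PowerSeries.mk p) t)
        - ∑ k ∈ Finset.range (N + 1), (p k : ℂ) * (1 - z ^ k)‖ ≤ 2 * f N := by
    refine h2.norm_le_of_bounded (h3.mul_left 2) fun k => ?_
    rw [norm_mul, Complex.norm_real, Real.norm_of_nonneg (h.nonneg _), mul_comm]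
    exact mul_le_mul_of_nonneg_right (norm_one_sub_exp_pow_le t _) (h.nonneg _)
  have h5 : ‖(f N : ℂ) * (1 - z ^ N)‖ ≤ 2 * f N := by
    rw [norm_mul, Complex.norm_real, Real.norm_of_nonneg (h.tail_pos _).le, mul_comm]
    exact mul_le_mul_of_nonneg_right (norm_one_sub_exp_pow_le t _) (h.tail_pos _).le
  rw [← h.sum_mul_one_sub_pow, ← sub_sub]
  exact (norm_sub_le _ _).trans (by linarith)

/-- A Riemann sum for `∫ x ^ (-β) exp (i s x)` over `(0, M + 1)`; only the existence of the limit
matters. -/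
theorem tendsto_truncated (h : RegVarLaw β p f) (s : ℝ) (M : ℕ) :
    ∃ l : ℂ, Tendsto (fun n : ℕ => (n : ℂ)⁻¹ * ((f n : ℂ)⁻¹ * ∑ k ∈ Finset.range (n * (M + 1)),
      (f k : ℂ) * Complex.exp (((s / n : ℝ) : ℂ) * Complex.I) ^ k)) atTop (𝓝 l) := by
  obtain ⟨γ, C, hγ0, hγ1, hC, hub⟩ := h.regVar.upper_nonneg h.index_lt_one
  have hfl : ∀ x : ℝ, 0 < x → Tendsto (fun n : ℕ => (⌊(n : ℝ) * x⌋₊ : ℝ) / n) atTop (𝓝 x) :=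
    fun x hx => tendsto_floor_mul_div hx.le
  have key := tendsto_riemann_sum (M := M + 1) (E := ℂ)
    (H := fun n k => ((f k / f n : ℝ) : ℂ) * Complex.exp (((s / n : ℝ) : ℂ) * Complex.I) ^ k)
    (h := fun x => ((x ^ (-β) : ℝ) : ℂ) * Complex.exp (((s * x : ℝ) : ℂ) * Complex.I))
    (b := fun x => C * 2 ^ γ * x ^ (-γ) + 1) ?_ ?_ ?_ ?_
  -- The term `k = 0`, equal to `1 / (n f n)`, is negligible.
  · have h0 : Tendsto (fun n : ℕ => ((((n : ℝ) * f n)⁻¹ : ℝ) : ℂ)) atTop (𝓝 ((0 : ℝ) : ℂ)) := by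
      refine (Complex.continuous_ofReal.tendsto _).comp ?_
      have : RegVar (1 - β) (fun n : ℕ => ((n : ℝ) * f n)⁻¹) :=
        (((RegVar.rpow 1).mul h.regVar).inv).congr (by ring) (fun n _ => by simp)
      exact this.tendsto_zero (by linarith [h.index_lt_one])
    refine ⟨_, (key.add h0).congr' ?_⟩
    filter_upwards [eventually_ge_atTop 1] with n hn
    have e : ∑ k ∈ Finset.Ico 1 (n * (M + 1)),
        ((f k / f n : ℝ) : ℂ) * Complex.exp (((s / n : ℝ) : ℂ) * Complex.I) ^ k
        = (f n : ℂ)⁻¹ * ∑ k ∈ Finset.Ico 1 (n * (M + 1)),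
          (f k : ℂ) * Complex.exp (((s / n : ℝ) : ℂ) * Complex.I) ^ k := by
      rw [Finset.mul_sum]
      refine Finset.sum_congr rfl fun k _ => ?_
      rw [Complex.ofReal_div]
      ring
    rw [Finset.range_eq_Ico, Finset.sum_eq_sum_Ico_succ_bot (Nat.mul_pos hn M.succ_pos),
      h.tail_zero, pow_zero, zero_add, Complex.real_smul, e]
    generalize ∑ k ∈ Finset.Ico 1 (n * (M + 1)),
      (f k : ℂ) * Complex.exp (((s / n : ℝ) : ℂ) * Complex.I) ^ k = T
    push_cast
    rw [mul_inv]
    ring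
  · refine Integrable.add ?_ (integrableOn_const (by simp))
    refine Integrable.const_mul ?_ _
    rw [← IntegrableOn, intervalIntegral.integrableOn_Ioo_rpow_iff (by positivity)]
    linarith
  · intro x hx
    have := hx.1
    positivity
  · intro n k x hx hn hk hkx
    have hfn := h.tail_pos n
    have hfk := h.tail_pos k
    have hx0 := hx.1
    rw [norm_coeff_mul_exp_pow, Complex.norm_real, Real.norm_of_nonneg (by positivity)]
    rcases le_total k n with hkn | hkn
    · rw [div_le_iff₀ hfn]
      have h1 := hub k n hk hkn
      have h2 := div_floor_rpow_le hγ0 hx0 hk hkx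
      calc f k ≤ C * f n * (2 ^ γ * x ^ (-γ)) := h1.trans (by gcongr)
        _ ≤ C * f n * (2 ^ γ * x ^ (-γ)) + f n := by linarith
        _ = _ := by ring
    · have h1 : f k / f n ≤ 1 := by rw [div_le_one hfn]; exact h.antitone hkn
      have h2 : 0 ≤ C * 2 ^ γ * x ^ (-γ) := by positivity
      linarith
  · intro x hx
    refine Tendsto.mul ?_ ?_
    · exact (Complex.continuous_ofReal.tendsto _).comp (h.regVar.ratio x hx.1 _ (hfl x hx.1))
    · have h1 : Tendsto (fun n : ℕ => Complex.exp
          (((s * ((⌊(n : ℝ) * x⌋₊ : ℝ) / n) : ℝ) : ℂ) * Complex.I)) atTop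
          (𝓝 (Complex.exp (((s * x : ℝ) : ℂ) * Complex.I))) := by
        have hc : Continuous fun y : ℝ => Complex.exp (((s * y : ℝ) : ℂ) * Complex.I) := by
          fun_prop
        exact (hc.tendsto x).comp (hfl x hx.1)
      refine h1.congr fun n => ?_
      rw [← Complex.exp_nat_mul]
      congr 1
      push_cast
      ring

theorem tendsto_mul_one_sub_exp (s : ℝ) :
    Tendsto (fun n : ℕ => (n : ℂ) * (1 - Complex.exp (((s / n : ℝ) : ℂ) * Complex.I))) atTop
      (𝓝 (-(s * Complex.I))) := by
  have hd : HasDerivAt (fun x : ℝ => Complex.exp (((s * x : ℝ) : ℂ) * Complex.I))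
      (s * Complex.I) 0 := by
    have h1 : HasDerivAt (fun x : ℝ => ((s * x : ℝ) : ℂ) * Complex.I) (s * Complex.I) 0 := by
      have := ((hasDerivAt_id (0 : ℝ)).const_mul s).ofReal_comp.mul_const Complex.I
      simpa using this
    simpa using h1.cexp
  have h2 := hd.tendsto_slope
  have h3 : Tendsto (fun n : ℕ => (n : ℝ)⁻¹) atTop (𝓝[≠] 0) := by
    refine tendsto_nhdsWithin_iff.2 ⟨tendsto_inv_atTop_zero.comp tendsto_natCast_atTop_atTop, ?_⟩
    filter_upwards [eventually_ge_atTop 1] with n hn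
    have hn0 : (0 : ℝ) < n := by exact_mod_cast hn
    exact (inv_pos.2 hn0).ne'
  refine (h2.comp h3).neg.congr fun n => ?_
  simp only [Function.comp, slope, sub_zero, inv_inv, mul_zero, vsub_eq_sub, Complex.ofReal_zero,
    zero_mul, Complex.exp_zero, Complex.real_smul, Complex.ofReal_natCast, div_eq_mul_inv]
  ring

/-- The rescaled characteristic exponents converge. -/
theorem exists_tendsto_exponent (h : RegVarLaw β p f) (s : ℝ) :
    ∃ l : ℂ, Tendsto (fun n : ℕ => (1 - circleEval (PowerSeries.mk p) (s / n)) / f n) atTop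
      (𝓝 l) := by
  refine exists_tendsto_of_approx fun ε hε => ?_
  -- Truncation at `n (M + 1)` costs `4 f (n (M + 1)) / f n`, which tends to `4 (M + 1) ^ (-β)` as
  -- `n → ∞`.
  have h1 : Tendsto (fun M : ℕ => 4 * ((M + 1 : ℕ) : ℝ) ^ (-β)) atTop (𝓝 0) := by
    have := ((tendsto_rpow_neg_atTop h.pos_index).comp
      (tendsto_natCast_atTop_atTop.comp (tendsto_add_atTop_nat 1))).const_mul 4
    simpa using this
  obtain ⟨M, hM⟩ := (h1.eventually (gt_mem_nhds hε)).exists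
  obtain ⟨l, hl⟩ := h.tendsto_truncated s M
  refine ⟨_, _, (tendsto_mul_one_sub_exp s).mul hl, ?_⟩
  have h2 : Tendsto (fun n => 4 * (f (n * (M + 1)) / f n)) atTop
      (𝓝 (4 * ((M + 1 : ℕ) : ℝ) ^ (-β))) := by
    refine (h.regVar.ratio _ (by positivity) _ (tendsto_const_nhds.congr' ?_)).const_mul 4
    filter_upwards [eventually_ge_atTop 1] with n hn
    have hn0 : (0 : ℝ) < n := by exact_mod_cast hn
    push_cast
    field_simp
  filter_upwards [h2.eventually (gt_mem_nhds hM), eventually_ge_atTop 1] with n hn hn1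
  refine le_trans ?_ hn.le
  have hn0 : (n : ℂ) ≠ 0 := by exact_mod_cast (by omega : n ≠ 0)
  have hfn := h.tail_pos n
  have e : (1 - circleEval (PowerSeries.mk p) (s / n)) / f n
      - (n : ℂ) * (1 - Complex.exp (((s / n : ℝ) : ℂ) * Complex.I))
        * ((n : ℂ)⁻¹ * ((f n : ℂ)⁻¹ * ∑ k ∈ Finset.range (n * (M + 1)),
          (f k : ℂ) * Complex.exp (((s / n : ℝ) : ℂ) * Complex.I) ^ k))
      = ((1 - circleEval (PowerSeries.mk p) (s / n))
        - (1 - Complex.exp (((s / n : ℝ) : ℂ) * Complex.I)) * ∑ k ∈ Finset.range (n * (M + 1)),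
          (f k : ℂ) * Complex.exp (((s / n : ℝ) : ℂ) * Complex.I) ^ k) * (f n : ℂ)⁻¹ := by
    field_simp
  rw [e, norm_mul, norm_inv, Complex.norm_real, Real.norm_of_nonneg hfn.le, ← div_eq_mul_inv,
    ← mul_div_assoc]
  exact div_le_div_of_nonneg_right (h.norm_one_sub_circleEval_sub_le _ _) hfn.le

end RegVarLaw
end Renewal

/-! ### The scaling limit and Doney's strong renewal theorem. -/

namespace Renewal
open PowerSeries

theorem integrable_two_power {A B a q : ℝ} (ha : a < 1) (hq : 1 < q) :
    Integrable (fun s : ℝ => if |s| ≤ 1 then A * |s| ^ (-a) else B * |s| ^ (-q)) := by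
  have h := (integrable_fun_norm_addHaar (volume : Measure ℝ)
    (f := fun x : ℝ => if x ≤ 1 then A * x ^ (-a) else B * x ^ (-q))).2
  simp only [Module.finrank_self, Nat.sub_self, pow_zero, one_smul, Real.norm_eq_abs] at h
  refine h ?_
  rw [← Set.Ioc_union_Ioi_eq_Ioi (zero_le_one (α := ℝ))]
  refine IntegrableOn.union ?_ ?_
  · have h1 : IntegrableOn (fun x : ℝ => A * x ^ (-a)) (Set.Ioc 0 1) := by
      refine Integrable.const_mul ?_ A
      rw [← IntegrableOn, integrableOn_Ioc_iff_integrableOn_Ioo,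
        intervalIntegral.integrableOn_Ioo_rpow_iff one_pos]
      linarith
    exact h1.congr_fun (fun x hx => by simp [hx.2]) measurableSet_Ioc
  · have h1 : IntegrableOn (fun x : ℝ => B * x ^ (-q)) (Set.Ioi 1) :=
      Integrable.const_mul (integrableOn_Ioi_rpow_of_lt (by linarith) one_pos) B
    exact h1.congr_fun (fun x hx => by simp [not_le.2 (Set.mem_Ioi.1 hx)]) measurableSet_Ioi

namespace RegVarLaw
variable {β : ℝ} {p f u : ℕ → ℝ}

theorem renewalSeries (h : RegVarLaw β p f)
    (hu : ∀ n, ∑ k ∈ Finset.range (n + 1), u k * f (n - k) = 1) :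
    RenewalSeries (PowerSeries.mk p) (PowerSeries.mk f) (PowerSeries.mk u) := by
  have h1 : 1 - PowerSeries.mk p = (1 - X) * PowerSeries.mk f := by
    ext n
    rw [sub_mul, one_mul, map_sub, map_sub, coeff_mk, coeff_mk, coeff_one]
    cases n with
    | zero => simp [h.zero, h.tail_zero]
    | succ n => rw [coeff_succ_X_mul, coeff_mk, h.succ]; simp
  have h2 : PowerSeries.mk u * PowerSeries.mk f = PowerSeries.mk 1 := by
    ext n
    rw [coeff_mk_mul_mk, hu, coeff_mk, Pi.one_apply]
  refine ⟨fun n => ?_, fun n => ?_, ?_, h1, ?_⟩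
  · rw [coeff_mk]; exact h.nonneg n
  · rw [coeff_mk]; exact (h.tail_pos n).le
  · rw [coeff_mk, h.zero]
  · rw [h1, mul_left_comm, h2, mul_comm, mk_one_mul_one_sub_eq_one]

theorem intervalIntegrable_inv (h : RegVarLaw β p f) :
    IntervalIntegrable (fun t => ‖1 - circleEval (PowerSeries.mk p) t‖⁻¹) volume
      (-Real.pi) Real.pi := by
  have h0 := h.pos_index
  have h1 := h.index_lt_one
  have hpi := Real.pi_pos
  -- Only `n = 1` is needed here; the exponents `0` and `(1 + β) / 2 < 1` are integrable on the
  -- circle.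
  obtain ⟨K, hK, hb⟩ := h.exists_inv_bound le_rfl h0 (show β < (1 + β) / 2 by linarith)
  have hint : IntervalIntegrable (fun t : ℝ => (f 1)⁻¹ * (K * (1 + |t| ^ (-((1 + β) / 2)))))
      volume (-Real.pi) Real.pi := by
    refine IntervalIntegrable.const_mul (IntervalIntegrable.const_mul
      (intervalIntegrable_const.add ?_) _) _
    have h2 := integrable_two_power (A := 1) (B := 0) (a := (1 + β) / 2) (q := 2) (by linarith)
      (by norm_num)
    have h3 : Integrable (fun s : ℝ => (if |s| ≤ 1 then 1 * |s| ^ (-((1 + β) / 2))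
        else 0 * |s| ^ (-2 : ℝ))) (volume.restrict (Set.uIoc (-Real.pi) Real.pi)) := h2.restrict
    have h4 : IntegrableOn (fun _ : ℝ => (1 : ℝ)) (Set.uIoc (-Real.pi) Real.pi) :=
      integrableOn_const (by simp [Set.uIoc])
    rw [intervalIntegrable_iff]
    refine (h3.add h4).mono' (Measurable.aestronglyMeasurable (by fun_prop))
      (ae_of_all _ fun s => ?_)
    have hs : 0 ≤ |s| ^ (-((1 + β) / 2)) := Real.rpow_nonneg (abs_nonneg _) _
    rw [Real.norm_of_nonneg hs, Pi.add_apply]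
    split_ifs with hs1
    · linarith
    · have : |s| ^ (-((1 + β) / 2)) ≤ 1 :=
        Real.rpow_le_one_of_one_le_of_nonpos (not_le.1 hs1).le (by linarith)
      linarith
  have hc := h.absSummable.continuous.measurable
  refine hint.mono_fun' (Measurable.aestronglyMeasurable (by fun_prop)) ?_
  refine (ae_restrict_iff' measurableSet_uIoc).2 ?_
  filter_upwards [Measure.ae_ne volume (0 : ℝ)] with t ht0 ht
  rw [Set.uIoc_of_le (by linarith)] at ht
  have := hb 1 le_rfl t ht0 (by rw [Nat.cast_one, one_mul, abs_le]; exact ⟨ht.1.le, ht.2⟩)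
  rw [Nat.cast_one, div_one, neg_zero, Real.rpow_zero] at this
  rw [norm_inv, norm_norm]
  have hf1 := h.tail_pos 1
  rw [inv_mul_eq_div, le_div_iff₀ hf1]
  linarith

/-- The scaling limit of the part of the renewal mass that stems from many renewals. -/
theorem exists_tendsto_coeff (h : RegVarLaw β p f)
    (hu : ∀ n, ∑ k ∈ Finset.range (n + 1), u k * f (n - k) = 1) {δ : ℝ} (hδ : 0 < δ) {M : ℕ}
    (hM : 1 < β / 2 * (M + 1 : ℕ)) {V : ℕ → PowerSeries ℝ}
    (hV : ∀ n, V n * (C (1 + f n / δ) - PowerSeries.mk p) = 1) :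
    ∃ l : ℂ, Tendsto (fun n : ℕ => 2 * Real.pi *
      (((n * f n * (f n / δ) ^ M * coeff n (PowerSeries.mk u * V n ^ M) : ℝ)) : ℂ))
      atTop (𝓝 l) := by
  have h0 := h.pos_index
  have h1 := h.index_lt_one
  have hpi := Real.pi_pos
  set φ := circleEval (PowerSeries.mk p) with hφ
  have hφc : Measurable φ := h.absSummable.continuous.measurable
  -- The exponent `(1 + β) / 2 < 1` keeps the singularity at `0` integrable. The exponent `β / 2`
  -- gives decay at infinity, which with the `M` extra factors becomes integrable by `hM`.
  obtain ⟨K, hK, hb⟩ := h.exists_inv_bound (show 0 ≤ β / 2 by linarith)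
    (show β / 2 < β by linarith) (show β < (1 + β) / 2 by linarith)
  choose ψ hψ using h.exists_tendsto_exponent
  set ψn : ℕ → ℝ → ℂ := fun n s => (1 - φ (s / n)) / f n with hψn
  have hψre : ∀ n s, 0 ≤ (ψn n s).re := fun n s => by
    simp only [hψn]
    rw [Complex.div_ofReal_re]
    exact div_nonneg (h.re_nonneg _) (h.tail_pos n).le
  have hψb : ∀ n : ℕ, 1 ≤ n → ∀ s : ℝ, s ≠ 0 → |s| ≤ n * Real.pi →
      ‖(ψn n s)⁻¹‖ ≤ K * (|s| ^ (-(β / 2)) + |s| ^ (-((1 + β) / 2))) := by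
    intro n hn s hs hsn
    refine le_trans (le_of_eq ?_) (hb n hn s hs hsn)
    simp only [hψn]
    rw [inv_div, norm_div, Complex.norm_real, Real.norm_of_nonneg (h.tail_pos n).le,
      div_eq_mul_inv]
  have hψlim : ∀ s : ℝ, Tendsto (fun n => ψn n s) atTop (𝓝 (ψ s)) := hψ
  have hψlre : ∀ s, 0 ≤ (ψ s).re := fun s =>
    ge_of_tendsto' ((Complex.continuous_re.tendsto _).comp (hψlim s)) fun n => hψre n s
  have hev : ∀ s : ℝ, ∀ᶠ n : ℕ in atTop, 1 ≤ n ∧ |s| < n * Real.pi := fun s =>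
    (eventually_ge_atTop 1).and ((tendsto_natCast_atTop_atTop.atTop_mul_const
      hpi).eventually_gt_atTop _)
  -- The uniform bound on `(ψn n s)⁻¹` survives in the limit as a positive lower bound for `‖ψ s‖`.
  have hψne : ∀ s : ℝ, s ≠ 0 → ψ s ≠ 0 := by
    intro s hs h00
    have hs0 : 0 < |s| := abs_pos.2 hs
    have hBpos : 0 < K * (|s| ^ (-(β / 2)) + |s| ^ (-((1 + β) / 2))) := by positivity
    have h2 : (K * (|s| ^ (-(β / 2)) + |s| ^ (-((1 + β) / 2))))⁻¹ ≤ ‖ψ s‖ := by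
      refine ge_of_tendsto (hψlim s).norm ?_
      filter_upwards [hev s] with n hn
      have hne : ψn n s ≠ 0 := by
        refine div_ne_zero (sub_ne_zero.2 (h.circleEval_ne_one ?_ ?_).symm)
          (by exact_mod_cast (h.tail_pos n).ne')
        · have : (0 : ℝ) < n := by exact_mod_cast hn.1
          rw [abs_div, Nat.abs_cast, div_le_iff₀ this]
          linarith [hn.2]
        · exact div_ne_zero hs (by exact_mod_cast (by omega : n ≠ 0))
      have := hψb n hn.1 s hs hn.2.le
      rw [norm_inv] at this
      exact inv_le_of_inv_le₀ (norm_pos_iff.2 hne) this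
    rw [h00, norm_zero] at h2
    have := inv_pos.2 hBpos
    linarith
  have hδψ : ∀ w : ℂ, 0 ≤ w.re → 0 ≤ ((δ : ℂ) * w).re := fun w hw => by
    rw [Complex.re_ofReal_mul]; exact mul_nonneg hδ.le hw
  -- The Fourier integrand at `t = s / n` and `ε = f n / δ`, with the prefactor `f n (f n / δ) ^ M`
  -- absorbed; the remaining `n` is the Jacobian.
  set G : ℕ → ℝ → ℂ := fun n s => (ψn n s)⁻¹ * ((1 + δ * ψn n s)⁻¹) ^ M
    * Complex.exp (-s * Complex.I) with hG
  have hEn : ∀ s : ℝ, ‖Complex.exp (-s * Complex.I)‖ = 1 := fun s => by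
    have := Complex.norm_exp_ofReal_mul_I (-s)
    push_cast at this
    exact this
  have hmain : Tendsto (fun n : ℕ => ∫ s, (Set.Ioc (-(n * Real.pi)) (n * Real.pi)).indicator (G n) s)
      atTop (𝓝 (∫ s, (ψ s)⁻¹ * ((1 + δ * ψ s)⁻¹) ^ M * Complex.exp (-s * Complex.I))) := by
    refine tendsto_integral_filter_of_dominated_convergence
      (fun s => if |s| ≤ 1 then 2 * K * |s| ^ (-((1 + β) / 2))
        else (2 * K) ^ (M + 1) * δ⁻¹ ^ M * |s| ^ (-(β / 2 * (M + 1 : ℕ)))) ?_ ?_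
      (integrable_two_power (by linarith) hM) ?_
    · refine Eventually.of_forall fun n => ?_
      refine AEStronglyMeasurable.indicator (Measurable.aestronglyMeasurable ?_) measurableSet_Ioc
      simp only [hG, hψn]
      fun_prop
    · filter_upwards [eventually_ge_atTop 1] with n hn
      filter_upwards [Measure.ae_ne volume (0 : ℝ)] with s hs
      have hs0 : 0 < |s| := abs_pos.2 hs
      by_cases hmem : s ∈ Set.Ioc (-(n * Real.pi)) (n * Real.pi)
      swap
      · rw [Set.indicator_of_notMem hmem, norm_zero]
        split_ifs <;> positivity
      rw [Set.indicator_of_mem hmem]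
      have hbd := hψb n hn s hs (abs_le.2 ⟨hmem.1.le, hmem.2⟩)
      have hre := hδψ _ (hψre n s)
      have h3 : ‖(1 + δ * ψn n s)⁻¹‖ ≤ 1 := by
        rw [norm_inv]
        refine inv_le_one_of_one_le₀ ?_
        have := le_norm_add_of_re_nonneg hre 1
        rwa [Complex.ofReal_one] at this
      simp only [hG]
      rw [norm_mul, hEn, mul_one, norm_mul, norm_pow]
      split_ifs with hs1
      · calc ‖(ψn n s)⁻¹‖ * ‖(1 + δ * ψn n s)⁻¹‖ ^ M
            ≤ (K * (|s| ^ (-(β / 2)) + |s| ^ (-((1 + β) / 2)))) * 1 ^ M := by gcongr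
          _ ≤ (K * (|s| ^ (-((1 + β) / 2)) + |s| ^ (-((1 + β) / 2)))) * 1 := by
            rw [one_pow]
            gcongr (K * (?_ + _)) * 1
            exact Real.rpow_le_rpow_of_exponent_ge hs0 hs1 (by linarith)
          _ = _ := by ring
      · have hs1' : 1 ≤ |s| := (not_le.1 hs1).le
        have hbd2 : ‖(ψn n s)⁻¹‖ ≤ 2 * K * |s| ^ (-(β / 2)) := by
          refine hbd.trans ?_
          have : |s| ^ (-((1 + β) / 2)) ≤ |s| ^ (-(β / 2)) :=
            Real.rpow_le_rpow_of_exponent_le hs1' (by linarith)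
          calc _ ≤ K * (|s| ^ (-(β / 2)) + |s| ^ (-(β / 2))) := by gcongr
            _ = _ := by ring
        -- For large `|s|` each of the `M` factors thus contributes a further `|s| ^ (-(β / 2))`.
        have h4 : ‖(1 + δ * ψn n s)⁻¹‖ ≤ δ⁻¹ * ‖(ψn n s)⁻¹‖ := by
          by_cases hz : ψn n s = 0
          · exfalso
            refine div_ne_zero (sub_ne_zero.2 (h.circleEval_ne_one ?_ ?_).symm)
              (by exact_mod_cast (h.tail_pos n).ne') hz
            · have : (0 : ℝ) < n := by exact_mod_cast hn
              rw [abs_div, Nat.abs_cast, div_le_iff₀ this, mul_comm Real.pi]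
              exact abs_le.2 ⟨hmem.1.le, hmem.2⟩
            · exact div_ne_zero hs (by exact_mod_cast (by omega : n ≠ 0))
          rw [norm_inv, norm_inv, ← mul_inv]
          refine inv_anti₀ (mul_pos hδ (norm_pos_iff.2 hz)) ?_
          have := norm_le_norm_add_of_re_nonneg hre zero_le_one
          rw [norm_mul, Complex.norm_real, Real.norm_of_nonneg hδ.le, Complex.ofReal_one] at this
          exact this
        calc ‖(ψn n s)⁻¹‖ * ‖(1 + δ * ψn n s)⁻¹‖ ^ M
            ≤ ‖(ψn n s)⁻¹‖ * (δ⁻¹ * ‖(ψn n s)⁻¹‖) ^ M := by gcongr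
          _ = δ⁻¹ ^ M * ‖(ψn n s)⁻¹‖ ^ (M + 1) := by ring
          _ ≤ δ⁻¹ ^ M * (2 * K * |s| ^ (-(β / 2))) ^ (M + 1) := by gcongr
          _ = _ := by
            rw [mul_pow, ← Real.rpow_natCast (|s| ^ _), ← Real.rpow_mul hs0.le, neg_mul]; ring
    · filter_upwards [Measure.ae_ne volume (0 : ℝ)] with s hs
      have h5 : 1 + δ * ψ s ≠ 0 := by
        intro h00
        have := le_norm_add_of_re_nonneg (hδψ _ (hψlre s)) 1
        rw [Complex.ofReal_one, h00, norm_zero] at this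
        linarith
      have h6 : Tendsto (fun n => G n s) atTop
          (𝓝 ((ψ s)⁻¹ * ((1 + δ * ψ s)⁻¹) ^ M * Complex.exp (-s * Complex.I))) := by
        refine Tendsto.mul_const _ (((hψlim s).inv₀ (hψne s hs)).mul (Tendsto.pow ?_ M))
        exact (((hψlim s).const_mul _).const_add _).inv₀ h5
      refine h6.congr' ?_
      filter_upwards [hev s] with n hn
      rw [Set.indicator_of_mem]
      have := abs_lt.1 hn.2
      exact ⟨this.1, this.2.le⟩
  refine ⟨_, hmain.congr' ?_⟩
  filter_upwards [eventually_ge_atTop 1] with n hn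
  have hn0 : (0 : ℝ) < n := by exact_mod_cast hn
  have hfn := h.tail_pos n
  have hfn' : (f n : ℂ) ≠ 0 := by exact_mod_cast hfn.ne'
  have hδ' : (δ : ℂ) ≠ 0 := by exact_mod_cast hδ.ne'
  have hF := (h.renewalSeries hu).coeff_mul_pow_eq_integral h.absSummable
    h.intervalIntegrable_inv (fun t ht ht0 => h.circleEval_ne_one (by
      rw [Set.uIoc_of_le (by linarith)] at ht
      exact abs_le.2 ⟨ht.1.le, ht.2⟩) ht0) h.re_nonneg (div_pos hfn hδ) (hV n) M n
  rw [integral_indicator measurableSet_Ioc, ← intervalIntegral.integral_of_le (by nlinarith)]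
  have hsc := intervalIntegral.integral_comp_div (a := -(n * Real.pi)) (b := n * Real.pi)
    (fun t : ℝ => (1 - φ t)⁻¹ * (((f n / δ : ℝ) + (1 - φ t))⁻¹) ^ M
        * Complex.exp (-(n * t) * Complex.I)) hn0.ne'
  rw [neg_div, mul_div_cancel_left₀ _ hn0.ne', ← hF] at hsc
  have e : ∀ s : ℝ, G n s = (f n * (f n / δ) ^ M : ℂ) * ((1 - φ (s / n))⁻¹
      * (((f n / δ : ℝ) + (1 - φ (s / n)))⁻¹) ^ M
        * Complex.exp (-(n * (s / n : ℝ)) * Complex.I)) := by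
    intro s
    simp only [hG, hψn]
    have e1 : (-(n * (s / n : ℝ)) * Complex.I : ℂ) = -s * Complex.I := by
      have : (n : ℂ) ≠ 0 := by exact_mod_cast hn0.ne'
      push_cast
      field_simp
    have e2 : (1 + δ * ((1 - φ (s / n)) / f n))⁻¹
        = (f n / δ : ℂ) * ((f n / δ : ℝ) + (1 - φ (s / n)))⁻¹ := by
      have : (1 + δ * ((1 - φ (s / n)) / f n) : ℂ)
          = (f n / δ : ℂ)⁻¹ * ((f n / δ : ℝ) + (1 - φ (s / n))) := by
        push_cast
        field_simp
      rw [this, mul_inv, inv_inv]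
    rw [e1, e2, mul_pow, inv_div, div_eq_mul_inv]
    ring
  simp_rw [e]
  rw [intervalIntegral.integral_const_mul, hsc, Complex.real_smul]
  push_cast
  ring

/-- **Doney's strong renewal theorem**: under Doney's condition the renewal masses `u` satisfy
`u n ∼ c / (n f n)`, with the constant dictated by the renewal equation. -/
theorem tendsto_renewal_mass (h : RegVarLaw β p f)
    (hu : ∀ n, ∑ k ∈ Finset.range (n + 1), u k * f (n - k) = 1)
    {D : ℝ} (hD : 0 ≤ D) (hDoney : ∀ n : ℕ, n * p n ≤ D * f n) :
    Tendsto (fun n : ℕ => n * f n * u n) atTop (𝓝 (Real.Gamma β * Real.Gamma (1 - β))⁻¹) := by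
  have hR := h.renewalSeries hu
  obtain ⟨M, hM⟩ : ∃ M : ℕ, 1 < β / 2 * (M + 1 : ℕ) := by
    obtain ⟨M, hM⟩ := exists_nat_gt (2 / β)
    refine ⟨M, ?_⟩
    have := h.pos_index
    rw [div_lt_iff₀ this] at hM
    push_cast
    nlinarith
  set S := D * ∑ i ∈ Finset.range M, ((i : ℝ) + 1) with hS
  have hS0 : 0 ≤ S := by positivity
  have hlim : ∃ c, Tendsto (fun n : ℕ => n * f n * u n) atTop (𝓝 c) := by
    refine exists_tendsto_of_approx fun ε hε => ?_
    -- With discount parameter `f n / δ`, the few-renewals part of `n f n u n` is at most `S * δ`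
    -- for every `n`.
    set δ := ε / (S + 1) with hδ
    have hδ0 : 0 < δ := by positivity
    have hε0 : ∀ n, 0 < f n / δ := fun n => div_pos (h.tail_pos n) hδ0
    choose V hV using fun n => exists_mul_C_sub hR.coeff_zero_P
      (show 0 < 1 + f n / δ by linarith [hε0 n])
    obtain ⟨l, hl⟩ := h.exists_tendsto_coeff hu hδ0 hM hV
    refine ⟨fun n => n * f n * (f n / δ) ^ M * coeff n (PowerSeries.mk u * V n ^ M),
      (2 * Real.pi)⁻¹ * l.re, ?_, Eventually.of_forall fun n => ?_⟩
    · refine (((Complex.continuous_re.tendsto _).comp hl).const_mul (2 * Real.pi)⁻¹).congr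
        fun n => ?_
      have hpi := Real.pi_pos
      have e : (2 * Real.pi : ℂ) = ((2 * Real.pi : ℝ) : ℂ) := by push_cast; rfl
      rw [Function.comp_apply, e, ← Complex.ofReal_mul, Complex.ofReal_re,
        inv_mul_cancel_left₀ (by positivity)]
    · have h1 := hR.abs_coeff_sub_le (hε0 n) (hV n) hD (fun n => by
        rw [coeff_mk, coeff_mk]; exact hDoney n) M n
      rw [coeff_mk] at h1
      have hfn := h.tail_pos n
      have e : n * f n * u n - n * f n * (f n / δ) ^ M * coeff n (PowerSeries.mk u * V n ^ M)
          = f n * (n * (u n - (f n / δ) ^ M * coeff n (PowerSeries.mk u * V n ^ M))) := by ring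
      rw [e, norm_mul, norm_mul, Real.norm_of_nonneg hfn.le, Real.norm_natCast, Real.norm_eq_abs]
      calc _ ≤ f n * (D * (f n / δ)⁻¹ * ∑ i ∈ Finset.range M, ((i : ℝ) + 1)) := by gcongr
        _ = S * δ := by rw [hS]; field_simp
        _ ≤ (S + 1) * δ := by gcongr; linarith
        _ = ε := by rw [hδ]; field_simp
  obtain ⟨c, hc⟩ := hlim
  -- The convolution of `u` and `f` is identically `1` and tends to `c Γ(β) Γ(1 - β)`, which
  -- determines `c`.
  have h2 := h.regVar.tendsto_renewal_conv h.pos_index h.index_lt_one hc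
  simp_rw [hu] at h2
  have h3 := tendsto_nhds_unique h2 tendsto_const_nhds
  rwa [eq_inv_of_mul_eq_one_left h3] at hc

end RegVarLaw
end Renewal

/-! ### The renewal property and the last common renewal. -/

namespace Renewal

/-- `t` is a partial sum of the sequence `y`. -/
def IsPartialSum (y : ℕ → ℕ) (t : ℕ) : Prop := ∃ n, ∑ i ∈ Finset.range n, y i = t

theorem isPartialSum_zero (y : ℕ → ℕ) : IsPartialSum y 0 := ⟨0, by simp⟩

theorem isPartialSum_shift {y : ℕ → ℕ} {n k : ℕ} (hn : ∑ i ∈ Finset.range n, y i = k) (t : ℕ) :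
    IsPartialSum (fun i => y (n + i)) t ↔ IsPartialSum y (k + t) := by
  constructor
  · rintro ⟨l, hl⟩
    exact ⟨n + l, by rw [Finset.sum_range_add, hn, hl]⟩
  · rintro ⟨l, hl⟩
    rcases le_total n l with h | h
    · obtain ⟨r, rfl⟩ := Nat.exists_eq_add_of_le h
      rw [Finset.sum_range_add, hn] at hl
      exact ⟨r, Nat.add_left_cancel hl⟩
    -- A partial sum of at most `n` terms is at most `k`, so here `t = 0`.
    · have : ∑ i ∈ Finset.range l, y i ≤ ∑ i ∈ Finset.range n, y i :=
        Finset.sum_le_sum_of_subset (Finset.range_mono h)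
      exact ⟨0, by simp; omega⟩

/-- Sequences for which `k` is a partial sum, the sequence of terms after it belonging to `E`. -/
def restartSet (k : ℕ) (E : Set (ℕ → ℕ)) : Set (ℕ → ℕ) :=
  {y | ∃ n, ∑ i ∈ Finset.range n, y i = k ∧ (fun i => y (n + i)) ∈ E}

/-- Sequences with a prescribed set of partial sums up to `N`. -/
def patternSet (N : ℕ) (a : Set (Fin (N + 1))) : Set (ℕ → ℕ) :=
  {y | ∀ t : Fin (N + 1), t ∈ a ↔ IsPartialSum y t}

theorem measurableSet_isPartialSum (t : ℕ) : MeasurableSet {y : ℕ → ℕ | IsPartialSum y t} := by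
  have : {y : ℕ → ℕ | IsPartialSum y t}
      = ⋃ n, {y : ℕ → ℕ | ∑ i ∈ Finset.range n, y i = t} := by
    ext y; simp [IsPartialSum]
  rw [this]
  refine MeasurableSet.iUnion fun n => ?_
  have hm : Measurable fun y : ℕ → ℕ => ∑ i ∈ Finset.range n, y i := by fun_prop
  exact hm (measurableSet_singleton t)

theorem measurableSet_restartSet (k : ℕ) {E : Set (ℕ → ℕ)} (hE : MeasurableSet E) :
    MeasurableSet (restartSet k E) := by
  have : restartSet k E = ⋃ n, ({y : ℕ → ℕ | ∑ i ∈ Finset.range n, y i = k}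
      ∩ (fun (y : ℕ → ℕ) (i : ℕ) => y (n + i)) ⁻¹' E) := by
    ext y; simp [restartSet]
  rw [this]
  refine MeasurableSet.iUnion fun n => MeasurableSet.inter ?_ ?_
  · have hm : Measurable fun y : ℕ → ℕ => ∑ i ∈ Finset.range n, y i := by fun_prop
    exact hm (measurableSet_singleton k)
  · exact (measurable_pi_iff.2 fun i => measurable_pi_apply (n + i)) hE

theorem measurableSet_patternSet (N : ℕ) (a : Set (Fin (N + 1))) :
    MeasurableSet (patternSet N a) := by
  have : patternSet N a = ⋂ t : Fin (N + 1), {y | t ∈ a ↔ IsPartialSum y t} := by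
    ext y; simp [patternSet]
  rw [this]
  refine MeasurableSet.iInter fun t => ?_
  by_cases h : t ∈ a
  · simpa [h] using measurableSet_isPartialSum t
  · simp only [h, false_iff]
    exact (measurableSet_isPartialSum t).compl

variable {Ω : Type*} [MeasurableSpace Ω]

section Single
variable {μ : Measure Ω} {X : ℕ → Ω → ℕ}

theorem IsRenewalProcess.measurable_seq (h : IsRenewalProcess μ X) :
    Measurable fun ω n => X n ω := measurable_pi_iff.2 h.measurable

theorem IsRenewalProcess.sum_strictMono (h : IsRenewalProcess μ X) (ω : Ω) :
    StrictMono fun n => ∑ i ∈ Finset.range n, X i ω :=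
  strictMono_nat_of_lt_succ fun n => by
    have := h.pos n ω
    rw [Finset.sum_range_succ]
    omega

theorem IsRenewalProcess.indepFun_shift [IsProbabilityMeasure μ] (h : IsRenewalProcess μ X)
    (n : ℕ) :
    IndepFun (fun ω => ∑ i ∈ Finset.range n, X i ω) (fun ω i => X (n + i) ω) μ := by
  have h1 := indep_iSup_of_disjoint (fun i => (h.measurable i).comap_le) h.indep.iIndep
    (S := Set.Iio n) (T := Set.Ici n) (Set.Iio_disjoint_Ici le_rfl)
  rw [IndepFun_iff_Indep]
  refine indep_of_indep_of_le_left (indep_of_indep_of_le_right h1 ?_) ?_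
  · rw [← measurable_iff_comap_le]
    refine @measurable_pi_lambda _ _ _ (_) _ _ fun i => ?_
    refine Measurable.mono (comap_measurable (X (n + i))) ?_ le_rfl
    exact le_iSup₂_of_le (n + i) (by simp) le_rfl
  · rw [← measurable_iff_comap_le]
    refine Finset.measurable_sum _ fun i hi => ?_
    refine Measurable.mono (comap_measurable (X i)) ?_ le_rfl
    exact le_iSup₂_of_le i (by simpa using hi) le_rfl

/-- Both laws are infinite products of the same marginal. -/
theorem IsRenewalProcess.map_shift (h : IsRenewalProcess μ X) (n : ℕ) :
    μ.map (fun ω i => X (n + i) ω) = μ.map (fun ω i => X i ω) := by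
  have h1 := (h.indep.precomp (g := fun i => n + i)
    (fun a b hab => by simpa using hab)).map_fun_eq_infinitePi_map (fun i => h.measurable (n + i))
  have h2 := h.indep.map_fun_eq_infinitePi_map h.measurable
  rw [h2]
  refine h1.trans ?_
  congr 1
  funext i
  exact (h.identDistrib (n + i)).map_eq.trans (h.identDistrib i).map_eq.symm

/-- The renewal property: after a renewal at time `k` the process starts afresh. -/
theorem IsRenewalProcess.measure_restartSet [IsProbabilityMeasure μ] (h : IsRenewalProcess μ X)
    (k : ℕ) {E : Set (ℕ → ℕ)} (hE : MeasurableSet E) :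
    μ ((fun ω n => X n ω) ⁻¹' restartSet k E)
      = μ {ω | IsPartialSum (fun n => X n ω) k} * μ ((fun ω n => X n ω) ⁻¹' E) := by
  have hS : ∀ n, Measurable fun ω => ∑ i ∈ Finset.range n, X i ω := fun n =>
    Finset.measurable_sum _ fun i _ => h.measurable i
  have hsh : ∀ n, Measurable fun ω i => X (n + i) ω := fun n =>
    measurable_pi_iff.2 fun i => h.measurable (n + i)
  set A : ℕ → Set Ω := fun n => (fun ω => ∑ i ∈ Finset.range n, X i ω) ⁻¹' {k} with hA
  have hAm : ∀ n, MeasurableSet (A n) := fun n => hS n (measurableSet_singleton k)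
  -- Gaps are positive, so level `k` is reached by at most one number of steps.
  have hdisj : Pairwise fun a b => Disjoint (A a) (A b) := by
    intro a b hab
    rw [Set.disjoint_left]
    intro ω h1 h2
    exact hab ((h.sum_strictMono ω).injective (h1.trans h2.symm))
  have e1 : (fun ω n => X n ω) ⁻¹' restartSet k E
      = ⋃ n, A n ∩ (fun ω i => X (n + i) ω) ⁻¹' E := by
    ext ω; simp [restartSet, hA]
  have e2 : {ω | IsPartialSum (fun n => X n ω) k} = ⋃ n, A n := by
    ext ω; simp [IsPartialSum, hA]
  rw [e1, e2, measure_iUnion hdisj hAm, measure_iUnion, ← ENNReal.tsum_mul_right]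
  · refine tsum_congr fun n => ?_
    rw [(indepFun_iff_measure_inter_preimage_eq_mul.1 (h.indepFun_shift n)) _ _
      (measurableSet_singleton k) hE, ← Measure.map_apply (hsh n) hE, h.map_shift,
      Measure.map_apply h.measurable_seq hE]
  · intro a b hab
    exact (hdisj hab).mono Set.inter_subset_left Set.inter_subset_left
  · exact fun n => (hAm n).inter (hsh n hE)

end Single

/-- The event that `k` is a common renewal time of all processes and that there is none in
`(k, k + N]`. -/
def lastCommonSet {m : ℕ} (Y : Fin m → ℕ → Ω → ℕ) (k N : ℕ) : Set Ω :=
  {ω | (∀ j, IsPartialSum (fun n => Y j n ω) k) ∧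
    ∀ t, 1 ≤ t → t ≤ N → ¬ ∀ j, IsPartialSum (fun n => Y j n ω) (k + t)}

section Joint
variable {μ : Measure Ω} {m : ℕ} {Y : Fin m → ℕ → Ω → ℕ}

theorem measurableSet_lastCommonSet (hY : ∀ j, IsRenewalProcess μ (Y j)) (k N : ℕ) :
    MeasurableSet (lastCommonSet Y k N) := by
  have hm : ∀ j t, MeasurableSet {ω | IsPartialSum (fun n => Y j n ω) t} := fun j t =>
    (hY j).measurable_seq (measurableSet_isPartialSum t)
  have : lastCommonSet Y k N = (⋂ j, {ω | IsPartialSum (fun n => Y j n ω) k}) ∩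
      ⋂ t, ⋂ (_ : 1 ≤ t), ⋂ (_ : t ≤ N), (⋂ j, {ω | IsPartialSum (fun n => Y j n ω) (k + t)})ᶜ := by
    ext ω; simp [lastCommonSet]
  rw [this]
  refine (MeasurableSet.iInter fun j => hm j k).inter (MeasurableSet.iInter fun t =>
    MeasurableSet.iInter fun _ => MeasurableSet.iInter fun _ =>
      (MeasurableSet.iInter fun j => hm j _).compl)

variable [IsProbabilityMeasure μ]

/-- Absence of common renewals is not a product event, but it is a disjoint union of product events,
one for each choice of renewal patterns of the processes on the window. On each of these the renewal
property splits off the probabilities of a renewal at `k`, leaving a factor independent of `k`. -/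
theorem exists_measure_lastCommonSet (hY : ∀ j, IsRenewalProcess μ (Y j))
    (hindep : iIndepFun (fun (j : Fin m) (ω : Ω) (n : ℕ) => Y j n ω) μ) (N : ℕ) :
    ∃ c, ∀ k, μ (lastCommonSet Y k N)
      = (∏ j, μ {ω | IsPartialSum (fun n => Y j n ω) k}) * c := by
  -- Offset `0` is exempt: it is the common renewal at `k` itself.
  let Good := {a : Fin m → Set (Fin (N + 1)) // ∀ t : Fin (N + 1), 1 ≤ (t : ℕ) → ∃ j, t ∉ a j}
  let Ev : ℕ → (Fin m → Set (Fin (N + 1))) → Set Ω := fun k a =>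
    ⋂ j, (fun ω n => Y j n ω) ⁻¹' restartSet k (patternSet N (a j))
  refine ⟨∑' a : Good, ∏ j, μ ((fun ω n => Y j n ω) ⁻¹' patternSet N (a.1 j)), fun k => ?_⟩
  have hmem : ∀ a ω, ω ∈ Ev k a ↔ ∀ j, IsPartialSum (fun n => Y j n ω) k ∧
      ∀ t : Fin (N + 1), t ∈ a j ↔ IsPartialSum (fun n => Y j n ω) (k + t) := by
    intro a ω
    simp only [Ev, Set.mem_iInter, Set.mem_preimage]
    refine forall_congr' fun j => ⟨?_, ?_⟩
    · rintro ⟨n, hn, hE⟩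
      exact ⟨⟨n, hn⟩, fun t => (hE t).trans (isPartialSum_shift hn t)⟩
    · rintro ⟨⟨n, hn⟩, hE⟩
      exact ⟨n, hn, fun t => (hE t).trans (isPartialSum_shift hn t).symm⟩
  have hmeasEv : ∀ a, MeasurableSet (Ev k a) := fun a => MeasurableSet.iInter fun j =>
    (hY j).measurable_seq (measurableSet_restartSet k (measurableSet_patternSet N _))
  have hdec : lastCommonSet Y k N = ⋃ a : Good, Ev k a.1 := by
    ext ω
    rw [Set.mem_iUnion]
    constructor
    · rintro ⟨h1, h2⟩
      refine ⟨⟨fun j => {t | IsPartialSum (fun n => Y j n ω) (k + t)}, fun t ht => ?_⟩, ?_⟩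
      · have := h2 t ht (by omega)
        simpa using this
      · exact (hmem _ _).2 fun j => ⟨h1 j, fun t => Iff.rfl⟩
    · rintro ⟨a, ha⟩
      have ha := (hmem _ _).1 ha
      refine ⟨fun j => (ha j).1, fun t h1 h2 hall => ?_⟩
      obtain ⟨j, hj⟩ := a.2 ⟨t, by omega⟩ h1
      exact hj (((ha j).2 ⟨t, by omega⟩).2 (hall j))
  have hdisj : Pairwise fun a b : Good => Disjoint (Ev k a.1) (Ev k b.1) := by
    intro a b hab
    rw [Set.disjoint_left]
    intro ω h1 h2
    have h1 := (hmem _ _).1 h1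
    have h2 := (hmem _ _).1 h2
    refine hab (Subtype.ext (funext fun j => Set.ext fun t => ?_))
    rw [(h1 j).2 t, (h2 j).2 t]
  rw [hdec, measure_iUnion hdisj fun a => hmeasEv a.1, ← ENNReal.tsum_mul_left]
  refine tsum_congr fun a => ?_
  have := hindep.meas_iInter (s := fun j =>
    (fun ω n => Y j n ω) ⁻¹' restartSet k (patternSet N (a.1 j))) fun j =>
      ⟨_, measurableSet_restartSet k (measurableSet_patternSet N _), rfl⟩
  simp only [Ev]
  rw [this, ← Finset.prod_mul_distrib]
  exact Finset.prod_congr rfl fun j _ =>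
    (hY j).measure_restartSet k (measurableSet_patternSet N _)

/-- Time `0` is always a renewal, so taking `k = 0` identifies the unspecified constant. -/
theorem measureReal_lastCommonSet (hY : ∀ j, IsRenewalProcess μ (Y j))
    (hindep : iIndepFun (fun (j : Fin m) (ω : Ω) (n : ℕ) => Y j n ω) μ) (k N : ℕ) :
    μ.real (lastCommonSet Y k N) = (∏ j, μ.real {ω | IsPartialSum (fun n => Y j n ω) k})
      * μ.real (lastCommonSet Y 0 N) := by
  obtain ⟨c, hc⟩ := exists_measure_lastCommonSet hY hindep N
  have h0 := hc 0
  simp only [isPartialSum_zero, Set.ofPred_true, measure_univ, Finset.prod_const_one,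
    one_mul] at h0
  simp only [Measure.real]
  rw [hc k, h0, ENNReal.toReal_mul, ENNReal.toReal_prod]

/-- Decomposition at the last common renewal time up to `n`. -/
theorem sum_mul_lastCommonSet (hY : ∀ j, IsRenewalProcess μ (Y j))
    (hindep : iIndepFun (fun (j : Fin m) (ω : Ω) (n : ℕ) => Y j n ω) μ) (n : ℕ) :
    ∑ k ∈ Finset.range (n + 1), (∏ j, μ.real {ω | IsPartialSum (fun n => Y j n ω) k})
      * μ.real (lastCommonSet Y 0 (n - k)) = 1 := by
  simp_rw [← measureReal_lastCommonSet hY hindep]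
  have huniv : ⋃ k ∈ Finset.range (n + 1), lastCommonSet Y k (n - k) = Set.univ := by
    refine Set.eq_univ_of_forall fun ω => ?_
    classical
    have h0 : ∃ k, k ≤ n ∧ ∀ j, IsPartialSum (fun n => Y j n ω) k :=
      ⟨0, n.zero_le, fun j => isPartialSum_zero _⟩
    set k := Nat.findGreatest (fun k => ∀ j, IsPartialSum (fun n => Y j n ω) k) n with hk
    have hkn : k ≤ n := Nat.findGreatest_le n
    have hk1 : ∀ j, IsPartialSum (fun n => Y j n ω) k :=
      Nat.findGreatest_spec (P := fun k => ∀ j, IsPartialSum (fun n => Y j n ω) k)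
        (Nat.zero_le n) fun j => isPartialSum_zero _
    simp only [Set.mem_iUnion]
    refine ⟨k, Finset.mem_range.2 (by omega), hk1, fun t h1 h2 => ?_⟩
    exact Nat.findGreatest_is_greatest (P := fun k => ∀ j, IsPartialSum (fun n => Y j n ω) k)
      (n := n) (k := k + t) (by omega) (by omega)
  have hdisj : Set.PairwiseDisjoint (↑(Finset.range (n + 1)) : Set ℕ)
      (fun k => lastCommonSet Y k (n - k)) := by
    intro a ha b hb hab
    rw [Function.onFun, Set.disjoint_left]
    rintro ω ⟨h1, h2⟩ ⟨h3, h4⟩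
    have ha' : a < n + 1 := by simpa using ha
    have hb' : b < n + 1 := by simpa using hb
    rcases lt_or_gt_of_ne hab with h | h
    · refine h2 (b - a) (by omega) (by omega) ?_
      rwa [Nat.add_sub_cancel' h.le]
    · refine h4 (a - b) (by omega) (by omega) ?_
      rwa [Nat.add_sub_cancel' h.le]
  rw [← measureReal_biUnion_finset hdisj fun k _ => measurableSet_lastCommonSet hY k _, huniv]
  simp

end Joint

theorem lastCommonSet_zero_eq_interGap {Ω : Type*} {m : ℕ} (Y : Fin m → ℕ → Ω → ℕ) (N : ℕ) :
    lastCommonSet Y 0 N = {ω | (N : ℕ∞) < interGap Y 0 ω} := by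
  ext ω
  -- `commonRenewals` asks for at least one step while `IsPartialSum` allows none; at positive times
  -- this makes no difference.
  have hcr : ∀ t, t ∈ commonRenewals Y ω ↔ 1 ≤ t ∧ ∀ j, IsPartialSum (fun n => Y j n ω) t := by
    intro t
    refine and_congr_right fun ht => forall_congr' fun j => ⟨?_, ?_⟩
    · rintro ⟨n, _, hn⟩
      exact ⟨n, hn.symm⟩
    · rintro ⟨n, hn⟩
      refine ⟨n, ?_, hn.symm⟩
      rcases Nat.eq_zero_or_pos n with h | h
      · subst h; simp at hn; omega
      · exact h
  simp only [lastCommonSet, Set.mem_ofPred_eq, interGap, interTime, nextGap, isPartialSum_zero,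
    implies_true, true_and, zero_add]
  constructor
  · intro h
    have h1 : ((N + 1 : ℕ) : ℕ∞) ≤ sInf {x : ℕ∞ | ∃ l : ℕ, x = (l : ℕ∞) ∧ 1 ≤ l ∧
        ∃ s ∈ commonRenewals Y ω, (s : ℕ∞) = (l : ℕ∞)} := by
      refine le_sInf ?_
      rintro x ⟨l, rfl, hl, s, hs, hsl⟩
      have hsl' : s = l := by exact_mod_cast hsl
      subst hsl'
      have : ¬ s ≤ N := fun hN => h s hl hN ((hcr s).1 hs).2
      exact_mod_cast (by omega : N + 1 ≤ s)
    refine lt_of_lt_of_le ?_ h1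
    exact_mod_cast Nat.lt_succ_self N
  · intro h t h1 h2 hall
    have : sInf {x : ℕ∞ | ∃ l : ℕ, x = (l : ℕ∞) ∧ 1 ≤ l ∧
        ∃ s ∈ commonRenewals Y ω, (s : ℕ∞) = (l : ℕ∞)} ≤ (t : ℕ∞) :=
      sInf_le ⟨t, rfl, h1, t, (hcr t).2 ⟨h1, hall⟩, rfl⟩
    have h3 : (N : ℕ∞) < t := h.trans_le this
    have : N < t := by exact_mod_cast h3
    omega

/-- For a single process every renewal is common, so the last common renewal decomposition
specialises to the ordinary renewal equation. -/
theorem lastCommonSet_zero_eq_tail {μ : Measure Ω} {X : ℕ → Ω → ℕ} (h : IsRenewalProcess μ X)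
    (N : ℕ) : lastCommonSet (fun _ : Fin 1 => X) 0 N = {ω | N < X 0 ω} := by
  ext ω
  simp only [lastCommonSet, Set.mem_ofPred_eq, isPartialSum_zero, implies_true, true_and, zero_add,
    forall_const]
  constructor
  · intro h1
    by_contra h2
    exact h1 (X 0 ω) (h.pos 0 ω) (not_lt.1 h2) ⟨1, by simp⟩
  · rintro h1 t ht htN ⟨n, hn⟩
    cases n with
    | zero => simp at hn; omega
    | succ n =>
      rw [Finset.sum_range_succ'] at hn
      omega

end Renewal

/-! ### From the hypotheses to regularly varying laws, and the conclusion. -/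

namespace Renewal

theorem RegVar.const_mul {β c : ℝ} {g : ℕ → ℝ} (h : RegVar β g) (hc : 0 < c) :
    RegVar β (fun n => c * g n) := by
  refine ⟨fun n hn => mul_pos hc (h.pos n hn), fun y hy k hk => ?_, fun γ hγ => ?_,
    fun γ hγ => ?_⟩
  · exact (h.ratio y hy k hk).congr fun n => (mul_div_mul_left _ _ hc.ne').symm
  · obtain ⟨C, hC⟩ := h.upper γ hγ
    refine ⟨C, fun m n hm hmn => ?_⟩
    have := mul_le_mul_of_nonneg_left (hC m n hm hmn) hc.le
    linarith
  · obtain ⟨C, hC⟩ := h.lower γ hγ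
    refine ⟨C, fun m n hm hmn => ?_⟩
    have := mul_le_mul_of_nonneg_left (hC m n hm hmn) hc.le
    linarith

variable {Ω : Type*} [MeasurableSpace Ω] {μ : Measure Ω} [IsProbabilityMeasure μ]

theorem tail_antitone (X : ℕ → Ω → ℕ) : Antitone (tail μ X) := fun _ _ hmn =>
  measureReal_mono fun _ hω => lt_of_le_of_lt hmn hω

theorem IsRenewalProcess.regVarLaw {X : ℕ → Ω → ℕ} (h : IsRenewalProcess μ X) {β : ℝ} {L : ℕ → ℝ}
    (hap : Aperiodic μ X) (hβ : β ∈ Set.Ioo (0 : ℝ) 1) (hL : SlowlyVarying L)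
    (htail : ∀ n : ℕ, 1 ≤ n → tail μ X n = (n : ℝ) ^ (-β) * L n) :
    RegVarLaw β (mass μ X) (tail μ X) := by
  have hpos : ∀ n, 0 < tail μ X n := by
    intro n
    obtain ⟨N, hN⟩ := eventually_atTop.1 hL.eventually_pos
    -- `L` is only eventually positive; positivity of the tail at a large `k` passes down to `n` by
    -- monotonicity.
    set k := max (max N 1) n
    have hk1 : 1 ≤ k := (le_max_right N 1).trans (le_max_left _ _)
    have hk : 0 < tail μ X k := by
      rw [htail k hk1]
      have : (0 : ℝ) < k := by exact_mod_cast hk1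
      exact mul_pos (Real.rpow_pos_of_pos this _) (hN k ((le_max_left N 1).trans (le_max_left _ _)))
    exact hk.trans_le (tail_antitone X (le_max_right _ _))
  have hreg : RegVar β (tail μ X) := by
    refine RegVar.of_antitone hβ.1 hpos (tail_antitone X) fun c hc => ?_
    have hfl : Tendsto (fun n : ℕ => (⌊c * (n : ℝ)⌋₊ : ℝ) / n) atTop (𝓝 c) :=
      (tendsto_floor_mul_div hc.le).congr fun n => by rw [mul_comm]
    have hfl' : Tendsto (fun n : ℕ => ⌊c * (n : ℝ)⌋₊) atTop atTop :=
      tendsto_nat_floor_atTop.comp (tendsto_natCast_atTop_atTop.const_mul_atTop hc)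
    have h1 := (hfl.rpow_const (p := -β) (Or.inl hc.ne')).mul (hL.tendsto_ratio c hc)
    rw [mul_one] at h1
    refine h1.congr' ?_
    filter_upwards [eventually_ge_atTop 1, hfl'.eventually_ge_atTop 1] with n hn hk
    rw [htail n hn, htail _ hk, Real.div_rpow (Nat.cast_nonneg _) (Nat.cast_nonneg _),
      mul_div_mul_comm]
  refine ⟨hβ.1, hβ.2, ?_, fun n => ?_, ?_, hpos, tail_antitone X, hreg, hap⟩
  · have : {ω | X 0 ω = 0} = ∅ := by
      ext ω
      have := h.pos 0 ω
      simp only [Set.mem_ofPred_eq, Set.mem_empty_iff_false, iff_false]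
      omega
    simp [mass, this]
  · have e : {ω | n < X 0 ω} = {ω | X 0 ω = n + 1} ∪ {ω | n + 1 < X 0 ω} := by
      ext ω
      simp only [Set.mem_ofPred_eq, Set.mem_union]
      omega
    have hd : Disjoint {ω | X 0 ω = n + 1} {ω | n + 1 < X 0 ω} := by
      rw [Set.disjoint_left]
      intro ω h1 h2
      simp only [Set.mem_ofPred_eq] at h1 h2
      omega
    have hm : MeasurableSet {ω | n + 1 < X 0 ω} := h.measurable 0 measurableSet_Ioi
    unfold tail mass
    rw [e, measureReal_union hd hm]
    ring
  · have : {ω | 0 < X 0 ω} = Set.univ := Set.eq_univ_of_forall fun ω => h.pos 0 ω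
    simp [tail, this]

theorem IsRenewalProcess.tendsto_renewal_mass {X : ℕ → Ω → ℕ} (h : IsRenewalProcess μ X) {β : ℝ}
    (hlaw : RegVarLaw β (mass μ X) (tail μ X)) (hD : DoneyCondition μ X) :
    Tendsto (fun n : ℕ => n * tail μ X n * μ.real {ω | IsPartialSum (fun i => X i ω) n}) atTop
      (𝓝 (Real.Gamma β * Real.Gamma (1 - β))⁻¹) := by
  obtain ⟨D, hD⟩ := hD
  refine hlaw.tendsto_renewal_mass (fun n => ?_) (le_max_right D 0) fun n => ?_
  · have := sum_mul_lastCommonSet (Y := fun _ : Fin 1 => X) (fun _ => h)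
      iIndepFun.of_subsingleton n
    simpa [lastCommonSet_zero_eq_tail h, tail] using this
  · have h1 := hD ⟨n, rfl⟩
    have h2 := hlaw.tail_pos n
    rw [div_le_iff₀ h2] at h1
    exact h1.trans (mul_le_mul_of_nonneg_right (le_max_left _ _) h2.le)

end Renewal

theorem lemmaA1 {Ω : Type*} [MeasurableSpace Ω] (μ : Measure Ω) [IsProbabilityMeasure μ]
    {m : ℕ} (Y : Fin m → ℕ → Ω → ℕ) (β : Fin m → ℝ) (L : Fin m → ℕ → ℝ)
    (hY : ∀ j, Renewal.IsRenewalProcess μ (Y j))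
    (hindep : iIndepFun (fun (j : Fin m) (ω : Ω) (n : ℕ) => Y j n ω) μ)
    (hap : ∀ j, Renewal.Aperiodic μ (Y j))
    (hβ : ∀ j, β j ∈ Set.Ioo (0 : ℝ) 1)
    (hL : ∀ j, Renewal.SlowlyVarying (L j))
    (htail : ∀ j, ∀ n : ℕ, 1 ≤ n → Renewal.tail μ (Y j) n = (n : ℝ) ^ (-β j) * L j n)
    (hDoney : ∀ j, Renewal.DoneyCondition μ (Y j))
    (hβstar : Renewal.betaStar β ∈ Set.Ioo (0 : ℝ) 1) :
    Renewal.interTail μ Y ~[atTop]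
      fun n : ℕ => (n : ℝ) ^ (-Renewal.betaStar β) * Renewal.LStar β L n := by
  open Renewal in
  have hlaw := fun j => (hY j).regVarLaw (hap j) (hβ j) (hL j) (htail j)
  set a : Fin m → ℝ := fun j => Real.Gamma (β j) * Real.Gamma (1 - β j) with ha
  have ha0 : ∀ j, 0 < a j := fun j => mul_pos (Real.Gamma_pos_of_pos (hβ j).1)
    (Real.Gamma_pos_of_pos (by linarith [(hβ j).2]))
  set B := Real.Gamma (betaStar β) * Real.Gamma (1 - betaStar β) with hB
  have hB0 : 0 < B := mul_pos (Real.Gamma_pos_of_pos hβstar.1)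
    (Real.Gamma_pos_of_pos (by linarith [hβstar.2]))
  -- Normalised so that `n g n` times the product of the `m` renewal masses tends to `1`: of the `m`
  -- factors `n`, one stays outside `g`.
  set g : ℕ → ℝ := fun n => (n : ℝ) ^ ((m : ℝ) - 1) * ∏ j, a j * tail μ (Y j) n with hg
  have hgreg : RegVar (betaStar β) g :=
    ((RegVar.rpow ((m : ℝ) - 1)).mul (RegVar.prod Finset.univ fun j _ =>
      (hlaw j).regVar.const_mul (ha0 j))).congr (by rw [betaStar]; ring) fun n _ => rfl
  have hu : Tendsto (fun n : ℕ => n * g n * ∏ j, μ.real {ω | IsPartialSum (fun i => Y j i ω) n})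
      atTop (𝓝 1) := by
    have h1 : Tendsto (fun n : ℕ => ∏ j, a j * (n * tail μ (Y j) n
        * μ.real {ω | IsPartialSum (fun i => Y j i ω) n})) atTop (𝓝 (∏ j, a j * (a j)⁻¹)) :=
      tendsto_finsetProd _ fun j _ =>
        ((hY j).tendsto_renewal_mass (hlaw j) (hDoney j)).const_mul (a j)
    simp only [mul_inv_cancel₀ (ha0 _).ne', Finset.prod_const_one] at h1
    refine h1.congr' ?_
    filter_upwards [eventually_ge_atTop 1] with n hn
    have hn0 : (0 : ℝ) < n := by exact_mod_cast hn
    simp only [hg]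
    -- Merging the powers requires the exponent `m` to be nonzero; `m = 0` would give `betaStar β =
    -- 1`.
    rw [← mul_assoc, ← Real.rpow_one_add' hn0.le (by
      rw [add_sub_cancel]
      intro hm
      have hm0 : m = 0 := by exact_mod_cast hm
      subst hm0
      simp [betaStar] at hβstar), add_sub_cancel, Real.rpow_natCast]
    simp only [Finset.prod_mul_distrib, Finset.prod_const, Finset.card_univ, Fintype.card_fin]
    ring
  have hF : ∀ n, interTail μ Y n = μ.real (lastCommonSet Y 0 n) := fun n => by
    rw [lastCommonSet_zero_eq_interGap, interTail]
  have hmain : Tendsto (fun n => interTail μ Y n / g n) atTop (𝓝 B⁻¹) := by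
    refine hgreg.tendsto_tail hβstar.1 hβstar.2 hu (fun k n hkn => ?_) (fun n => measureReal_nonneg)
      (fun n => measureReal_le_one) fun n => ?_
    · refine measureReal_mono fun ω hω => ?_
      have hω' : (n : ℕ∞) < interGap Y 0 ω := hω
      exact lt_of_le_of_lt (by exact_mod_cast hkn) hω'
    · simp_rw [hF]
      exact sum_mul_lastCommonSet hY hindep n
  have htarget : ∀ n : ℕ, 1 ≤ n →
      (n : ℝ) ^ (-betaStar β) * LStar β L n = B⁻¹ * g n := by
    intro n hn
    have hn0 : (0 : ℝ) < n := by exact_mod_cast hn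
    have e : ∀ j, a j * tail μ (Y j) n = (n : ℝ) ^ (-β j) * (a j * L j n) := fun j => by
      rw [htail j n hn]; ring
    simp only [hg, e, Finset.prod_mul_distrib (f := fun j => (n : ℝ) ^ (-β j))]
    rw [← Real.rpow_sum_of_pos hn0, ← mul_assoc ((n : ℝ) ^ _), ← Real.rpow_add hn0, LStar,
      Finset.sum_neg_distrib, show (m : ℝ) - 1 + -∑ j, β j = -betaStar β by rw [betaStar]; ring]
    rw [div_eq_inv_mul]
    ring
  have hgpos : ∀ᶠ n in atTop, 0 < g n := by
    filter_upwards [eventually_ge_atTop 1] with n hn using hgreg.pos n hn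
  refine (isEquivalent_iff_tendsto_one ?_).2 ?_
  · filter_upwards [hgpos, eventually_ge_atTop 1] with n h1 hn
    rw [htarget n hn]
    exact (mul_pos (inv_pos.2 hB0) h1).ne'
  · have := hmain.mul_const B
    rw [inv_mul_cancel₀ hB0.ne'] at this
    refine this.congr' ?_
    filter_upwards [hgpos, eventually_ge_atTop 1] with n h1 hn
    rw [Pi.div_apply, htarget n hn]
    field_simp
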